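/- Let $K$ be a field of characteristic different from $2$ (for instance $K=\mathbb{C}$), let $p,q,r\ge 0$ and $0\le d\le e$ be integers, and put $s=p+q+r$. Let $L=K(x_1,y_1,\dots,x_s,y_s)$ be the field of rational functions in $2s$ variables, so that $(x_1,y_1),\dots,(x_s,y_s)$ are generic points of (an affine chart of) $\mathbb{P}^1\times\mathbb{P}^1$, and let $(m_1,\dots,m_s)=(1^{\times p},2^{\times q},3^{\times r})$. Let $\mathcal{L}_{(d,e)}(1^{\times p},2^{\times q},3^{\times r})$ be the $L$-vector space of polynomials $$f=\sum_{0\le\delta_1\le d,\;0\le\delta_2\le e}A_{\delta_1,\delta_2}X^{\delta_1}Y^{\delta_2}\in L[X,Y]$$ such that $$\frac{\partial^{\alpha+\beta}f}{\partial X^{\alpha}\partial Y^{\beta}}(x_i,y_i)=0\qquad\text{for } i=1,\dots,s \text{ and all } \alpha,\beta\ge 0 \text{ with } \alpha+\beta<m_i,$$ and let $M$ be the matrix, with $p+3q+6r$ rows and $(d+1)(e+1)$ columns, of this system of linear equations in the unknowns $A_{\delta_1,\delta_2}$. The linear system is called special if $M$ does not have maximal rank, i.e. if $\operatorname{rank}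 M\ne\min\{p+3q+6r,\,(d+1)(e+1)\}$. Theorem. The linear system $\mathcal{L}_{(d,e)}(1^{\times p},2^{\times q},3^{\times r})$ is special if and only if one of the following conditions holds: - (0) $d=0$, $p+2q+3r\le e$, and $q\ge 1$ or $r\ge 1$; - (1) $d=1$, $p+3q+5r\le 2e+1$ and $r\ge 1$; - (2) $d=2$, $p=0$, $e=q+2r-1$ and $2\nmid q+r$; - (3) $d=3$ and, for some integer $n\ge 1$, one of the following holds: - (3.1) $e=3n$, $p=q=0$ and $r=2n+1$; - (3.2) $e=3n$, $p\le 1$, $q=1$ and $r=2n$; - (3.3) $e=3n+1$, $p\le 2$, $q=0$ and $r=2n+1$; - (3.4) $e=3n+2$, $p=0$, $q=2$ and $r=2n+1$; - (4) $d=4$, $e=5$, $p=q=0$ and $r=5$. -/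

import Mathlib

noncomputable section

namespace LinSys

open MvPolynomial

/-- The field `L` of rational functions over `K` in the coordinates of the base points
`(x_i, y_i)`, `i ∈ ι`. The coordinates `x_i`, `y_i` are the variables `(i, 0)`, `(i, 1)`. -/
abbrev RatFun (K : Type*) [Field K] (ι : Type) : Type _ :=
  FractionRing (MvPolynomial (ι × Fin 2) K)

/-- The generic point `(x_i, y_i)`. -/
def basePoint (K : Type*) [Field K] {ι : Type} (i : ι) : Fin 2 → RatFun K ι :=
  fun j => algebraMap (MvPolynomial (ι × Fin 2) K) (RatFun K ι) (X (i, j))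

/-- The orders of differentiation `(α, β)` with `α + β < m`. -/
def orders (m : ℕ) : Finset (ℕ × ℕ) :=
  (Finset.range m ×ˢ Finset.range m).filter (fun a => a.1 + a.2 < m)

/-- The value at the point `P` of the partial derivative of order `(α, β)` of `f ∈ F[X, Y]`,
where `X`, `Y` are the variables `0`, `1`. -/
def derivAt {F : Type*} [Field F] (P : Fin 2 → F) (a : ℕ × ℕ) (f : MvPolynomial (Fin 2) F) : F :=
  MvPolynomial.eval P ((pderiv 0)^[a.1] ((pderiv 1)^[a.2] f))

/-- The matrix `M_D(m)` of the equations `∂^(α+β) f / ∂X^α ∂Y^β (x_i, y_i) = 0`, `α + β < m_i`,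
in the unknown coefficients of `f = ∑_{δ ∈ D} A_δ X^δ₁ Y^δ₂`. The rows are indexed by the
equations and the columns by the elements of `D`. -/
def condMatrix (K : Type*) [Field K] {ι : Type} (D : Finset (ℕ × ℕ)) (m : ι → ℕ) :
    Matrix (Σ i : ι, {a : ℕ × ℕ // a ∈ orders (m i)}) {δ : ℕ × ℕ // δ ∈ D} (RatFun K ι) :=
  fun c δ => derivAt (basePoint K c.1) c.2.1 (X 0 ^ δ.1.1 * X 1 ^ δ.1.2)

/-- The linear system `L_D(m)` is special when `M_D(m)` is not of the maximal rank, that is, when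
its rank is not the minimum of its number of rows and its number of columns. -/
def IsSpecial (K : Type*) [Field K] {ι : Type} [Fintype ι] (D : Finset (ℕ × ℕ)) (m : ι → ℕ) :
    Prop :=
  (condMatrix K D m).rank ≠
    min (Fintype.card (Σ i : ι, {a : ℕ × ℕ // a ∈ orders (m i)}))
      (Fintype.card {δ : ℕ × ℕ // δ ∈ D})

/-- The diagram `{0, …, d} × {0, …, e}`. -/
def rectangle (d e : ℕ) : Finset (ℕ × ℕ) :=
  Finset.range (d + 1) ×ˢ Finset.range (e + 1)

/-- The multiplicities `1^{×p}, 2^{×q}, 3^{×r}`. -/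
def mults (p q r : ℕ) : Fin p ⊕ (Fin q ⊕ Fin r) → ℕ :=
  Sum.elim (fun _ => 1) (Sum.elim (fun _ => 2) (fun _ => 3))

end LinSys

end

/-!
The proof compares the generic rank with the rank for well chosen points in one direction, and
exhibits unexpectedly many curves in the other.

**Systems that are not special.** The rank of the condition matrix at generic points is at least its
rank at any points over any extension field of `K` (`not_isSpecial_of_le`). So it suffices to find
points over an infinite field `F ⊇ K` at which the conditions are injective on the polynomials of
bidegree `(d, e)`; if there are fewer conditions than coefficients, simple points are added until
there are equally many, and a nonsingular square matrix has independent rows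
(`not_isSpecial_of_square`). Taking the points in the torus, the conditions at a point `P` of
multiplicity `m` span the functions `ε ↦ g ε * P ^ ε` on the set of exponents, with `g` a polynomial
of degree less than `m`. Hence a single point imposes injective conditions on the polynomials with
exponents in `D` exactly when polynomials of degree less than `m` take arbitrary values on `D`; this
holds in particular if `D` can be exhausted by lines carrying at most `m`, `m - 1`, …, `1` of its
points (`interpolates_of_isUnisolvent`). Sets of exponents that are separated by a line are glued by
sending the points of one of them to infinity along a one-parameter subgroup of the torus
(`Injective.union`). Cutting a rectangle successively by half-planes therefore proves injectivity
for all its exponents. A finite table contains such dissections for small rectangles. All other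
rectangles are cut by horizontal and vertical lines into smaller ones (`rectInjective_one`, …,
`rectInjective_five`, `rectInjective_ge_six`), where two more facts are used: multiplicities may be
increased, and three simple points may take the place of a double point
(`Injective.double_to_simple`). The exceptional systems of the list are exactly the obstructions
met on the way.

**Special systems.** For `d ≤ 1` the conditions that differentiate more than `d` times in `X` are
void, and the remaining ones are too few (`rank_le_card_filter`). For `d ≥ 2` there is a polynomial
`g` of low degree through the points, found by counting constants, such that the products of `g`
with the members of another linear system belong to the given one. Since multiplication by `g` is
injective, this makes the kernel of the condition matrix larger than expected
(`rank_add_le_of_mem_system`, `isSpecial_of_mem_system`). For `d = 3` this `g` is the square of a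
curve of bidegree `(1, k)`.
-/

namespace LinSys

section
variable {F : Type*} [Field F]

/-! ### Exponential polynomials on the lattice of exponents -/

/-- The functions on `ℤ × ℤ` given by a polynomial of degree less than `m` in the two
coordinates. -/
def polyFun (F : Type*) [Field F] (m : ℕ) : Submodule F (ℤ × ℤ → F) :=
  Submodule.span F {f | ∃ i j : ℕ, i + j < m ∧ f = fun ε => (ε.1 : F) ^ i * (ε.2 : F) ^ j}

/-- The affine function `ε ↦ u · ε - c` on the lattice. -/
def affineFun (F : Type*) [Field F] (u : ℤ × ℤ) (c : ℤ) : ℤ × ℤ → F :=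
  fun ε => ((u.1 * ε.1 + u.2 * ε.2 - c : ℤ) : F)

lemma polyFun_mono {m n : ℕ} (h : m ≤ n) : polyFun F m ≤ polyFun F n :=
  Submodule.span_mono fun _ ⟨i, j, hij, hf⟩ => ⟨i, j, hij.trans_le h, hf⟩

lemma const_mem_polyFun (m : ℕ) (a : F) : (fun _ => a) ∈ polyFun F (m + 1) := by
  have h : (fun ε : ℤ × ℤ => (ε.1 : F) ^ 0 * (ε.2 : F) ^ 0) ∈ polyFun F (m + 1) :=
    Submodule.subset_span ⟨0, 0, by omega, rfl⟩
  have := Submodule.smul_mem _ a h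
  convert this using 1
  ext; simp

lemma affineFun_mul_mem {m : ℕ} {f : ℤ × ℤ → F} (hf : f ∈ polyFun F m) (u : ℤ × ℤ) (c : ℤ) :
    affineFun F u c * f ∈ polyFun F (m + 1) := by
  induction hf using Submodule.span_induction with
  | mem f hf =>
    obtain ⟨i, j, hij, rfl⟩ := hf
    have h1 : (fun ε : ℤ × ℤ => (ε.1 : F) ^ (i + 1) * (ε.2 : F) ^ j) ∈ polyFun F (m + 1) :=
      Submodule.subset_span ⟨i + 1, j, by omega, rfl⟩
    have h2 : (fun ε : ℤ × ℤ => (ε.1 : F) ^ i * (ε.2 : F) ^ (j + 1)) ∈ polyFun F (m + 1) :=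
      Submodule.subset_span ⟨i, j + 1, by omega, rfl⟩
    have h3 : (fun ε : ℤ × ℤ => (ε.1 : F) ^ i * (ε.2 : F) ^ j) ∈ polyFun F (m + 1) :=
      Submodule.subset_span ⟨i, j, by omega, rfl⟩
    have := Submodule.sub_mem _ (Submodule.add_mem _ (Submodule.smul_mem _ (u.1 : F) h1)
      (Submodule.smul_mem _ (u.2 : F) h2)) (Submodule.smul_mem _ (c : F) h3)
    convert this using 1
    ext ε
    simp [affineFun]
    ring
  | zero => simp
  | add f g _ _ hf hg => rw [mul_add]; exact Submodule.add_mem _ hf hg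
  | smul a f _ hf => rw [mul_smul_comm]; exact Submodule.smul_mem _ a hf

lemma affineFun_pow_mul_mem {m : ℕ} {f : ℤ × ℤ → F} (hf : f ∈ polyFun F m) (u : ℤ × ℤ) (c : ℤ)
    (k : ℕ) : affineFun F u c ^ k * f ∈ polyFun F (m + k) := by
  induction k with
  | zero => simpa using hf
  | succ k ih =>
    have := affineFun_mul_mem ih u c
    rwa [← mul_assoc, ← pow_succ', add_assoc] at this

/-- Polynomials of degree less than `m` are stable under affine substitutions. -/
lemma comp_mem_polyFun {m : ℕ} {f : ℤ × ℤ → F} (hf : f ∈ polyFun F m) (u v : ℤ × ℤ) (c d : ℤ) :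
    (fun ε => f (u.1 * ε.1 + u.2 * ε.2 - c, v.1 * ε.1 + v.2 * ε.2 - d)) ∈ polyFun F m := by
  induction hf using Submodule.span_induction with
  | mem f hf =>
    obtain ⟨i, j, hij, rfl⟩ := hf
    have h := affineFun_pow_mul_mem
      (affineFun_pow_mul_mem (const_mem_polyFun 0 (1 : F)) v d j) u c i
    refine polyFun_mono (by omega) (?_ : _ ∈ polyFun F (0 + 1 + j + i))
    convert h using 1
    ext ε
    simp [affineFun]
  | zero => exact Submodule.zero_mem _
  | add f g _ _ hf hg => exact Submodule.add_mem _ hf hg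
  | smul a f _ hf => exact Submodule.smul_mem _ a hf

/-- The exponential function `(a, b) ↦ x ^ a * y ^ b` attached to the point `P = (x, y)` of the
torus: its values are the values at `P` of the Laurent monomials. -/
def expo (P : Fˣ × Fˣ) : ℤ × ℤ → F := fun ε => ((P.1 ^ ε.1 * P.2 ^ ε.2 : Fˣ) : F)

/-- The exponential polynomials of exponent `P` and degree less than `m`. Restricted to a set of
exponents, they span the row space of the conditions "multiplicity at least `m` at `P`". -/
def jets (x : ℕ × Fˣ × Fˣ) : Submodule F (ℤ × ℤ → F) :=
  (polyFun F x.1).map (LinearMap.mulLeft F (expo x.2))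

lemma mem_jets {x : ℕ × Fˣ × Fˣ} {f : ℤ × ℤ → F} :
    f ∈ jets x ↔ ∃ g ∈ polyFun F x.1, expo x.2 * g = f := by
  simp [jets]

lemma jets_mono {m n : ℕ} (h : m ≤ n) (P : Fˣ × Fˣ) : jets (m, P) ≤ jets (n, P) :=
  Submodule.map_mono (polyFun_mono h)

/-- The span of the conditions imposed by a multiset of points with multiplicities. -/
def conds (c : Multiset (ℕ × Fˣ × Fˣ)) : Submodule F (ℤ × ℤ → F) := (c.map jets).sup

lemma conds_add (c c' : Multiset (ℕ × Fˣ × Fˣ)) : conds (c + c') = conds c ⊔ conds c' := by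
  simp [conds]

lemma conds_cons (x : ℕ × Fˣ × Fˣ) (c : Multiset (ℕ × Fˣ × Fˣ)) :
    conds (x ::ₘ c) = jets x ⊔ conds c := by
  simp [conds]

/-- Every function on the finite set `D` is the restriction of an element of `U`. -/
def Interpolates (U : Submodule F (ℤ × ℤ → F)) (D : Finset (ℤ × ℤ)) : Prop :=
  ∀ φ : ℤ × ℤ → F, ∃ h ∈ U, ∀ δ ∈ D, h δ = φ δ

lemma Interpolates.mono {U U' : Submodule F (ℤ × ℤ → F)} {D D' : Finset (ℤ × ℤ)}
    (h : Interpolates U D) (hU : U ≤ U') (hD : D' ⊆ D) : Interpolates U' D' := fun φ =>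
  let ⟨g, hg, hgD⟩ := h φ
  ⟨g, hU hg, fun δ hδ => hgD δ (hD hδ)⟩

/-- For a suitable choice of points with multiplicities `ms` over `F`, the conditions of vanishing
at these points are injective on the polynomials with exponents in `D`. -/
def Injective (F : Type*) [Field F] (D : Finset (ℤ × ℤ)) (ms : Multiset ℕ) : Prop :=
  ∃ c : Multiset (ℕ × Fˣ × Fˣ), c.map Prod.fst = ms ∧ Interpolates (conds c) D

lemma Injective.subset {D D' : Finset (ℤ × ℤ)} {ms : Multiset ℕ} (h : Injective F D ms)
    (hD : D' ⊆ D) : Injective F D' ms :=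
  let ⟨c, hc, hi⟩ := h
  ⟨c, hc, hi.mono le_rfl hD⟩

lemma Injective.cons {D : Finset (ℤ × ℤ)} {ms : Multiset ℕ} (h : Injective F D ms) (m : ℕ) :
    Injective F D (m ::ₘ ms) := by
  obtain ⟨c, hc, hi⟩ := h
  refine ⟨(m, 1, 1) ::ₘ c, by simp [hc], hi.mono ?_ subset_rfl⟩
  rw [conds_cons]
  exact le_sup_right

lemma Injective.increase {D : Finset (ℤ × ℤ)} {ms : Multiset ℕ} {m n : ℕ}
    (h : Injective F D (m ::ₘ ms)) (hmn : m ≤ n) : Injective F D (n ::ₘ ms) := by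
  obtain ⟨c, hc, hi⟩ := h
  obtain ⟨x, hx, hxm⟩ := Multiset.mem_map.mp (hc ▸ Multiset.mem_cons_self m ms)
  obtain ⟨c, rfl⟩ := Multiset.exists_cons_of_mem hx
  obtain ⟨k, P⟩ := x
  obtain rfl : k = m := hxm
  refine ⟨(n, P) ::ₘ c, by simpa using hc, hi.mono ?_ subset_rfl⟩
  rw [conds_cons, conds_cons]
  exact sup_le_sup_right (jets_mono hmn P) _

/-- Injectivity is invariant under affine changes of exponents. -/
lemma Injective.comp {D D' : Finset (ℤ × ℤ)} {ms : Multiset ℕ} (h : Injective F D ms)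
    (u v : ℤ × ℤ) (c d : ℤ)
    (hmaps : ∀ ε ∈ D', (u.1 * ε.1 + u.2 * ε.2 - c, v.1 * ε.1 + v.2 * ε.2 - d) ∈ D)
    (hinj : Set.InjOn (fun ε : ℤ × ℤ => (u.1 * ε.1 + u.2 * ε.2 - c, v.1 * ε.1 + v.2 * ε.2 - d))
      D') : Injective F D' ms := by
  classical
  obtain ⟨s, hs, hi⟩ := h
  set T : ℤ × ℤ → ℤ × ℤ :=
    fun ε => (u.1 * ε.1 + u.2 * ε.2 - c, v.1 * ε.1 + v.2 * ε.2 - d) with hT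
  let tr : Fˣ × Fˣ → Fˣ × Fˣ := fun P => (P.1 ^ u.1 * P.2 ^ v.1, P.1 ^ u.2 * P.2 ^ v.2)
  have hexpo : ∀ P : Fˣ × Fˣ, ∀ ε, expo P (T ε) = ((P.1 ^ c * P.2 ^ d)⁻¹ : Fˣ) * expo (tr P) ε := by
    intro P ε
    simp only [expo, hT, tr, ← Units.val_mul]
    congr 1
    simp only [zpow_sub, zpow_add, mul_zpow, mul_inv, ← zpow_mul]
    exact Units.ext (by push_cast; ring)
  have hcomp : ∀ (s : Multiset (ℕ × Fˣ × Fˣ)) (f : ℤ × ℤ → F), f ∈ conds s →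
      f ∘ T ∈ conds (s.map fun x => (x.1, tr x.2)) := by
    intro s
    induction s using Multiset.induction_on with
    | empty =>
      intro f hf
      simp only [conds, Multiset.map_zero, Multiset.sup_zero, Submodule.mem_bot] at hf ⊢
      subst hf; rfl
    | cons x s ih =>
      intro f hf
      rw [conds_cons, Submodule.mem_sup] at hf
      obtain ⟨f1, hf1, f2, hf2, rfl⟩ := hf
      rw [Multiset.map_cons, conds_cons]
      refine Submodule.add_mem_sup ?_ (ih f2 hf2)
      obtain ⟨g, hg, rfl⟩ := mem_jets.mp hf1
      refine mem_jets.mpr ⟨_, Submodule.smul_mem _ (((x.2.1 ^ c * x.2.2 ^ d)⁻¹ : Fˣ) : F)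
        (comp_mem_polyFun hg u v c d), ?_⟩
      ext ε
      simp only [Pi.mul_apply, Pi.smul_apply, smul_eq_mul, hexpo]
      ring
  refine ⟨s.map fun x => (x.1, tr x.2), by simpa using hs, fun φ => ?_⟩
  obtain ⟨h, hh, hD⟩ := hi fun ε => φ (Function.invFunOn T D' ε)
  refine ⟨h ∘ T, hcomp s h hh, fun δ hδ => ?_⟩
  rw [Function.comp_apply, hD _ (hmaps δ hδ)]
  congr 1
  exact hinj.leftInvOn_invFunOn hδ

/-! ### Gluing along a line -/

lemma conds_scale (t : Fˣ) (w : ℤ × ℤ) (s : Multiset (ℕ × Fˣ × Fˣ)) (f : ℤ × ℤ → F)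
    (hf : f ∈ conds s) :
    (fun ε => ((t ^ (w.1 * ε.1 + w.2 * ε.2) : Fˣ) : F) * f ε) ∈
      conds (s.map fun x => (x.1, (x.2.1 * t ^ w.1, x.2.2 * t ^ w.2))) := by
  induction s using Multiset.induction_on generalizing f with
  | empty =>
    simp only [conds, Multiset.map_zero, Multiset.sup_zero, Submodule.mem_bot] at hf ⊢
    subst hf; ext; simp
  | cons x s ih =>
    rw [conds_cons, Submodule.mem_sup] at hf
    obtain ⟨f1, hf1, f2, hf2, rfl⟩ := hf
    rw [Multiset.map_cons, conds_cons]
    obtain ⟨g, hg, rfl⟩ := mem_jets.mp hf1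
    refine Submodule.mem_sup.mpr ⟨_, mem_jets.mpr ⟨g, hg, rfl⟩, _, ih f2 hf2, ?_⟩
    ext ε
    simp only [Pi.add_apply, Pi.mul_apply, expo, mul_zpow, ← zpow_mul, zpow_add, Units.val_mul]
    ring

/-- If a line separates `D₁` from `D₂`, then injectivity on both sides gives injectivity on the
union: move the points used for `D₁` to infinity along a one-parameter subgroup of the torus. The
determinant of the joint conditions is a polynomial in the inverse of the parameter, and its
constant term is the determinant of a block triangular matrix. -/
theorem Injective.union [Infinite F] {D₁ D₂ : Finset (ℤ × ℤ)} {ms₁ ms₂ : Multiset ℕ}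
    (h₁ : Injective F D₁ ms₁) (h₂ : Injective F D₂ ms₂) (w : ℤ × ℤ)
    (hw : ∀ δ ∈ D₁, ∀ ε ∈ D₂, w.1 * ε.1 + w.2 * ε.2 < w.1 * δ.1 + w.2 * δ.2) :
    Injective F (D₁ ∪ D₂) (ms₁ + ms₂) := by
  classical
  obtain ⟨c₁, hc₁, hi₁⟩ := h₁
  obtain ⟨c₂, hc₂, hi₂⟩ := h₂
  choose f₁ hf₁ hfD₁ using fun δ : ℤ × ℤ => hi₁ (Pi.single δ 1)
  choose f₂ hf₂ hfD₂ using fun δ : ℤ × ℤ => hi₂ (Pi.single δ 1)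
  let ht : ℤ × ℤ → ℤ := fun ε => w.1 * ε.1 + w.2 * ε.2
  let B : Matrix D₁ D₂ (Polynomial F) := Matrix.of fun δ ε =>
    Polynomial.C (f₁ δ ε) * Polynomial.X ^ (ht δ - ht ε).toNat
  let C : Matrix D₂ D₁ F := Matrix.of fun δ ε => f₂ δ ε
  let N : Matrix (D₁ ⊕ D₂) (D₁ ⊕ D₂) (Polynomial F) :=
    Matrix.fromBlocks 1 B (C.map Polynomial.C) 1
  have hN : ∀ s : F, (Polynomial.evalRingHom s).mapMatrix N = Matrix.fromBlocks 1
      (Matrix.of fun (δ : D₁) (ε : D₂) => f₁ δ ε * s ^ (ht δ - ht ε).toNat) C 1 := by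
    intro s
    rw [RingHom.mapMatrix_apply, Matrix.fromBlocks_map]
    congr 1
    · exact (Polynomial.evalRingHom s).mapMatrix.map_one
    · ext δ ε; simp [B]
    · ext δ ε; simp
    · exact (Polynomial.evalRingHom s).mapMatrix.map_one
  have hlt : ∀ (δ : D₁) (ε : D₂), 0 < ht δ - ht ε := fun δ ε => sub_pos.mpr (hw δ δ.2 ε ε.2)
  have hN0 : N.det.eval 0 = 1 := by
    have h := (Polynomial.evalRingHom (0 : F)).map_det N
    rw [Polynomial.coe_evalRingHom] at h
    have hB : (Matrix.of fun (δ : D₁) (ε : D₂) => f₁ δ ε * (0 : F) ^ (ht δ - ht ε).toNat) =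
        (0 : Matrix D₁ D₂ F) := by
      ext δ ε
      have := hlt δ ε
      rw [Matrix.of_apply, zero_pow (by omega), mul_zero, Matrix.zero_apply]
    rw [h, hN, hB, Matrix.det_fromBlocks_zero₁₂, Matrix.det_one, Matrix.det_one, mul_one]
  obtain ⟨s, hs0, hs⟩ : ∃ s : F, s ≠ 0 ∧ N.det.eval s ≠ 0 := by
    by_contra hcon
    push Not at hcon
    have hzero : Polynomial.X * N.det = 0 := by
      apply Polynomial.funext
      intro r
      by_cases hr : r = 0
      · simp [hr]
      · simp [hcon r hr]
    rcases mul_eq_zero.mp hzero with h | h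
    · exact Polynomial.X_ne_zero h
    · rw [h] at hN0; simp at hN0
  let t : Fˣ := (Units.mk0 s hs0)⁻¹
  refine ⟨(c₁.map fun x => (x.1, (x.2.1 * t ^ w.1, x.2.2 * t ^ w.2))) + c₂, by simp [← hc₁, hc₂],
    fun φ => ?_⟩
  obtain ⟨M, hMdef⟩ : ∃ M, M = (Polynomial.evalRingHom s).mapMatrix N := ⟨_, rfl⟩
  have hM : IsUnit M.det := by
    rw [isUnit_iff_ne_zero, hMdef, ← RingHom.map_det]
    exact hs
  rw [hN] at hMdef
  -- the conditions that give the rows of `M`, on `D₁` and on `D₂` respectively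
  let rows : D₁ ⊕ D₂ → ℤ × ℤ → F := Sum.elim
    (fun δ ε => ((t ^ (-ht δ) : Fˣ) : F) * (((t ^ ht ε : Fˣ) : F) * f₁ δ ε)) (fun δ => f₂ δ)
  have hrows : ∀ i, rows i ∈
      conds ((c₁.map fun x => (x.1, (x.2.1 * t ^ w.1, x.2.2 * t ^ w.2))) + c₂) := by
    rintro (δ | δ)
    · rw [conds_add]
      exact Submodule.mem_sup_left (Submodule.smul_mem _ _ (conds_scale t w c₁ _ (hf₁ δ)))
    · rw [conds_add]
      exact Submodule.mem_sup_right (hf₂ δ)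
  let pt : D₁ ⊕ D₂ → ℤ × ℤ := Sum.elim (fun δ => δ) (fun δ => δ)
  have hMrows : ∀ i j, M i j = rows i (pt j) := by
    rintro (δ | δ) (ε | ε) <;> rw [hMdef]
    · rw [Matrix.fromBlocks_apply₁₁, show rows (Sum.inl δ) (pt (Sum.inl ε)) =
        ((t ^ (-ht δ) : Fˣ) : F) * (((t ^ ht ε : Fˣ) : F) * f₁ δ ε) from rfl, hfD₁ δ ε ε.2]
      by_cases h : δ = ε
      · subst h
        rw [Matrix.one_apply_eq, Pi.single_eq_same, mul_one, ← Units.val_mul, ← zpow_add,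
          neg_add_cancel, zpow_zero, Units.val_one]
      · rw [Matrix.one_apply_ne h, Pi.single_eq_of_ne (fun h' => h (Subtype.ext h'.symm)), mul_zero,
          mul_zero]
    · have := hlt δ ε
      rw [Matrix.fromBlocks_apply₁₂, Matrix.of_apply, show rows (Sum.inl δ) (pt (Sum.inr ε)) =
        ((t ^ (-ht δ) : Fˣ) : F) * (((t ^ ht ε : Fˣ) : F) * f₁ δ ε) from rfl, ← mul_assoc,
        ← Units.val_mul, ← zpow_add, mul_comm]
      have : t ^ (-ht δ + ht ε) = (Units.mk0 s hs0) ^ (ht δ - ht ε).toNat := by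
        rw [← zpow_natCast, Int.toNat_of_nonneg this.le, inv_zpow', neg_add,
          neg_neg, sub_eq_add_neg]
      rw [this, Units.val_pow_eq_pow_val, Units.val_mk0]
    · rw [Matrix.fromBlocks_apply₂₁]; rfl
    · rw [Matrix.fromBlocks_apply₂₂,
        show rows (Sum.inr δ) (pt (Sum.inr ε)) = f₂ δ ε from rfl, hfD₂ δ ε ε.2]
      by_cases h : δ = ε
      · subst h; rw [Matrix.one_apply_eq, Pi.single_eq_same]
      · rw [Matrix.one_apply_ne h, Pi.single_eq_of_ne (fun h' => h (Subtype.ext h'.symm))]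
  let y : D₁ ⊕ D₂ → F := Matrix.vecMul (φ ∘ pt) M⁻¹
  have hy : Matrix.vecMul y M = φ ∘ pt := by
    rw [Matrix.vecMul_vecMul, Matrix.nonsing_inv_mul _ hM, Matrix.vecMul_one]
  refine ⟨∑ i, y i • rows i, Submodule.sum_mem _ fun i _ => Submodule.smul_mem _ _ (hrows i), ?_⟩
  have key : ∀ j, (∑ i, y i • rows i) (pt j) = φ (pt j) := by
    intro j
    have := congrFun hy j
    simpa [Matrix.vecMul, dotProduct, hMrows, Finset.sum_apply] using this
  intro δ hδ
  rcases Finset.mem_union.mp hδ with h | h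
  · exact key (Sum.inl ⟨δ, h⟩)
  · exact key (Sum.inr ⟨δ, h⟩)

/-! ### Trading a double point for three simple points -/

/-- The restriction of functions to the finite set `D`. -/
def restrict (F : Type*) [Field F] (D : Finset (ℤ × ℤ)) : (ℤ × ℤ → F) →ₗ[F] (D → F) :=
  LinearMap.funLeft F F Subtype.val

lemma interpolates_iff {U : Submodule F (ℤ × ℤ → F)} {D : Finset (ℤ × ℤ)} :
    Interpolates U D ↔ U.map (restrict F D) = ⊤ := by
  classical
  rw [eq_top_iff]
  constructor
  · intro h φ _
    obtain ⟨g, hg, hgD⟩ := h fun ε => if hε : ε ∈ D then φ ⟨ε, hε⟩ else 0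
    refine ⟨g, hg, funext fun δ => ?_⟩
    have := hgD δ δ.2
    simpa [restrict, LinearMap.funLeft] using this
  · intro h φ
    obtain ⟨g, hg, hgD⟩ := h (Submodule.mem_top (x := fun δ : D => φ δ))
    exact ⟨g, hg, fun δ hδ => congrFun hgD ⟨δ, hδ⟩⟩

/-- Over an infinite field the Laurent monomials are linearly independent functions on the torus, so
the vectors of their values at all points span everything. -/
lemma exists_expo_notMem [Infinite F] {D : Finset (ℤ × ℤ)} {V : Submodule F (D → F)} (hV : V ≠ ⊤) :
    ∃ P : Fˣ × Fˣ, restrict F D (expo P) ∉ V := by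
  classical
  by_contra hcon
  push Not at hcon
  obtain ⟨f, hf0, hf⟩ := Submodule.exists_le_ker_of_lt_top V (lt_top_iff_ne_top.mpr hV)
  have hinf : ∀ k : ℤ, (∀ x : Fˣ, x ^ k = 1) → k = 0 := by
    have hnat : ∀ k : ℕ, (∀ x : Fˣ, x ^ k = 1) → k = 0 := by
      intro k hk
      by_contra hk0
      have : (Polynomial.X * (Polynomial.X ^ k - 1) : Polynomial F) = 0 := by
        apply Polynomial.funext
        intro x
        by_cases hx : x = 0
        · simp [hx]
        · have := congrArg Units.val (hk (Units.mk0 x hx))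
          simp only [Units.val_pow_eq_pow_val, Units.val_mk0, Units.val_one] at this
          simp [this]
      rcases mul_eq_zero.mp this with h | h
      · exact Polynomial.X_ne_zero h
      · exact Polynomial.X_pow_sub_C_ne_zero (Nat.pos_of_ne_zero hk0) (1 : F) (by simpa using h)
    intro k hk
    have := hnat k.natAbs fun x => by
      rcases Int.natAbs_eq k with h | h
      · rw [← zpow_natCast, ← h, hk]
      · rw [← zpow_natCast, ← inv_inj, ← zpow_neg, ← h, hk, inv_one]
    omega
  let χ : ℤ × ℤ → Fˣ × Fˣ →* F := fun ε =>
    { toFun := fun P => expo P ε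
      map_one' := by simp [expo]
      map_mul' := fun P Q => by
        simp only [expo, Prod.fst_mul, Prod.snd_mul, mul_zpow, ← Units.val_mul]
        congr 1
        exact mul_mul_mul_comm _ _ _ _ }
  have hχ : Function.Injective χ := by
    intro ε ε' h
    have h' : ∀ P : Fˣ × Fˣ, P.1 ^ ε.1 * P.2 ^ ε.2 = P.1 ^ ε'.1 * P.2 ^ ε'.2 := fun P =>
      Units.ext (DFunLike.congr_fun h P)
    have h1 := hinf (ε.1 - ε'.1) fun x => by
      have := h' (x, 1)
      simp only [one_zpow, mul_one] at this
      rw [zpow_sub, this, mul_inv_cancel]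
    have h2 := hinf (ε.2 - ε'.2) fun x => by
      have := h' (1, x)
      simp only [one_zpow, one_mul] at this
      rw [zpow_sub, this, mul_inv_cancel]
    exact Prod.ext (by omega) (by omega)
  have hli := (linearIndependent_monoidHom (Fˣ × Fˣ) F).comp (fun δ : D => χ δ)
    (hχ.comp Subtype.val_injective)
  rw [Fintype.linearIndependent_iff] at hli
  have hfun : ∀ φ : D → F, f φ = ∑ δ, f (Pi.single δ 1) * φ δ := by
    intro φ
    conv_lhs => rw [pi_eq_sum_univ' φ]
    simp [mul_comm]
  apply hf0
  have hz := hli (fun δ => f (Pi.single δ 1)) (by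
    ext P
    have := LinearMap.mem_ker.mp (hf (hcon P))
    rw [hfun] at this
    simpa [restrict, LinearMap.funLeft, χ, Finset.sum_apply] using this)
  ext φ
  simp [hz]

lemma exists_simple_points [Infinite F] {D : Finset (ℤ × ℤ)} (k : ℕ) (V : Submodule F (D → F))
    (h : D.card ≤ Module.finrank F V + k) : ∃ c : Multiset (ℕ × Fˣ × Fˣ),
      c.map Prod.fst = Multiset.replicate k 1 ∧ V ⊔ (conds c).map (restrict F D) = ⊤ := by
  induction k generalizing V with
  | zero =>
    refine ⟨0, rfl, ?_⟩
    have : V = ⊤ := Submodule.eq_top_of_finrank_eq (le_antisymm (Submodule.finrank_le V) (by simpa))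
    rw [this, top_sup_eq]
  | succ k ih =>
    by_cases hV : V = ⊤
    · exact ⟨Multiset.replicate (k + 1) (1, 1, 1), by simp, by rw [hV, top_sup_eq]⟩
    obtain ⟨P, hP⟩ := exists_expo_notMem hV
    have hlt : V < V ⊔ Submodule.span F {restrict F D (expo P)} := by
      refine lt_of_le_of_ne le_sup_left fun heq => hP ?_
      rw [heq]
      exact Submodule.mem_sup_right (Submodule.mem_span_singleton_self _)
    have := Submodule.finrank_lt_finrank_of_lt hlt
    obtain ⟨c, hc, hctop⟩ := ih (V ⊔ Submodule.span F {restrict F D (expo P)}) (by omega)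
    refine ⟨(1, P) ::ₘ c, by simp [hc, Multiset.replicate_succ], top_le_iff.mp (hctop ▸ ?_)⟩
    rw [conds_cons, Submodule.map_sup, ← sup_assoc]
    refine sup_le_sup_right (sup_le_sup_left ?_ _) _
    rw [Submodule.span_singleton_le_iff_mem]
    exact Submodule.mem_map_of_mem (mem_jets.mpr ⟨_, const_mem_polyFun 0 1, by ext; simp⟩)

lemma finrank_map_jets_two_le (D : Finset (ℤ × ℤ)) (P : Fˣ × Fˣ) :
    Module.finrank F ((jets (2, P)).map (restrict F D)) ≤ 3 := by
  classical
  let s : Finset (ℤ × ℤ → F) := {fun _ => 1, fun ε => (ε.1 : F), fun ε => (ε.2 : F)}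
  have hs : polyFun F 2 ≤ Submodule.span F s := by
    refine Submodule.span_mono ?_
    rintro f ⟨i, j, hij, rfl⟩
    obtain ⟨rfl, rfl⟩ | ⟨rfl, rfl⟩ | ⟨rfl, rfl⟩ :
      (i = 0 ∧ j = 0) ∨ (i = 1 ∧ j = 0) ∨ (i = 0 ∧ j = 1) := by omega
    all_goals simp [s]
  have h : (jets (2, P)).map (restrict F D) ≤
      Submodule.span F (s.image (restrict F D ∘ₗ LinearMap.mulLeft F (expo P))) := by
    rw [Finset.coe_image, Submodule.span_image, jets, ← Submodule.map_comp]
    exact Submodule.map_mono hs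
  calc _ ≤ _ := Submodule.finrank_mono h
    _ ≤ _ := finrank_span_finset_le_card _
    _ ≤ s.card := Finset.card_image_le
    _ ≤ 3 := Finset.card_le_three

/-- Three general simple points impose at least as much as a double point. -/
theorem Injective.double_to_simple [Infinite F] {D : Finset (ℤ × ℤ)} {ms : Multiset ℕ}
    (h : Injective F D (2 ::ₘ ms)) : Injective F D (Multiset.replicate 3 1 + ms) := by
  obtain ⟨c, hc, hi⟩ := h
  obtain ⟨x, hx, hxm⟩ := Multiset.mem_map.mp (hc ▸ Multiset.mem_cons_self 2 ms)
  obtain ⟨c, rfl⟩ := Multiset.exists_cons_of_mem hx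
  obtain ⟨k, P⟩ := x
  obtain rfl : k = 2 := hxm
  rw [interpolates_iff, conds_cons, Submodule.map_sup] at hi
  have hrank := Submodule.finrank_add_le_finrank_add_finrank ((jets (2, P)).map (restrict F D))
    ((conds c).map (restrict F D))
  rw [hi, finrank_top, Module.finrank_pi, Fintype.card_coe] at hrank
  have := finrank_map_jets_two_le D P
  obtain ⟨c', hc', htop⟩ := exists_simple_points 3 ((conds c).map (restrict F D)) (by omega)
  refine ⟨c' + c, by simpa [hc'] using hc, ?_⟩
  rw [interpolates_iff, conds_add, Submodule.map_sup, sup_comm, htop]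

/-! ### Sets of exponents that determine one multiple point -/

/-- The value at `ε` of the affine function `ε ↦ u · ε - c`. The operations on integers are named
explicitly here and below since the kernel has to evaluate these definitions. -/
def height (u : ℤ × ℤ) (c : ℤ) (ε : ℤ × ℤ) : ℤ :=
  Int.sub (Int.add (Int.mul u.1 ε.1) (Int.mul u.2 ε.2)) c

/-- The integer divides `8`, hence is invertible in every field of characteristic not `2`. -/
def isUnit (n : ℤ) : Bool := Nat.beq (Nat.mod 8 n.natAbs) 0

/-- Boolean test for `0 ≤ n`. -/
def isNonneg : ℤ → Bool
  | .ofNat _ => true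
  | .negSucc _ => false

/-- Boolean test for `n = 0`. -/
def isZero : ℤ → Bool
  | .ofNat n => Nat.beq n 0
  | .negSucc _ => false

/-- `forceNat n k` is `k n`, with `n` evaluated before it is passed on. -/
def forceNat {β : Type} : ℕ → (ℕ → β) → β
  | 0, k => k 0
  | n + 1, k => k (n + 1)

/-- `forceInt n k` is `k n`, with `n` evaluated before it is passed on. -/
def forceInt {β : Type} : ℤ → (ℤ → β) → β
  | .ofNat n, k => forceNat n fun n => k (.ofNat n)
  | .negSucc n, k => forceNat n fun n => k (.negSucc n)

/-- `forceList l k` is `k l`, with `l` evaluated before it is passed on. -/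
def forceList {β : Type} : List (ℤ × ℤ) → (List (ℤ × ℤ) → β) → β
  | [], k => k []
  | (x, y) :: l, k =>
    forceInt x fun x => forceInt y fun y => forceList l fun l => k ((x, y) :: l)

/-- `split s l k` is `k` applied to the sublists of `l` where `s` holds and where it fails, which
are evaluated before they are passed on. -/
def split {β : Type} (s : ℤ × ℤ → Bool) :
    List (ℤ × ℤ) → (List (ℤ × ℤ) → List (ℤ × ℤ) → β) → β
  | [], k => k [] []
  | ε :: l, k =>
    match s ε with
    | true => split s l fun on off => k (ε :: on) off
    | false => split s l fun on off => k on (ε :: off)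

/-- The directions of the lines used by `isUnisolvent`. -/
def directions : List (ℤ × ℤ) :=
  [(1, 0), (0, 1), (1, 1), (1, -1), (1, 2), (2, 1), (1, -2), (2, -1)]

/-- A sufficient condition for polynomials of degree less than `m` to take arbitrary values on the
set `D`, in every characteristic but `2`: some line contains at most `m` points of `D`, and the
points of `D` off this line satisfy the same condition for `m - 1`. -/
def isUnisolvent : ℕ → List (ℤ × ℤ) → Bool
  | 0, D => D.isEmpty
  | m + 1, D => D.isEmpty || directions.any fun u => D.any fun z =>
      forceInt (height u 0 z) fun c =>
      split (fun ε => isZero (height u c ε)) D fun on off =>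
      -- the bound on `off` is only there to discard wrong lines early
      Nat.ble on.length (m + 1) && Nat.ble (2 * off.length) (m * (m + 1)) &&
      (off.all fun ε => isUnit (height u c ε)) && isUnisolvent m off &&
      on.all fun δ => on.all fun ε =>
        δ == ε || isUnit (Int.sub δ.1 ε.1) || isUnit (Int.sub δ.2 ε.2)

lemma height_eq (u : ℤ × ℤ) (c : ℤ) (ε : ℤ × ℤ) :
    height u c ε = u.1 * ε.1 + u.2 * ε.2 - c := rfl

lemma isNonneg_iff {n : ℤ} : isNonneg n = true ↔ 0 ≤ n := by
  cases n <;> simp [isNonneg]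

lemma isZero_iff {n : ℤ} : isZero n = true ↔ n = 0 := by
  cases n <;> simp [isZero]

lemma forceNat_eq {β : Type} (n : ℕ) (k : ℕ → β) : forceNat n k = k n := by
  cases n <;> rfl

lemma forceInt_eq {β : Type} (n : ℤ) (k : ℤ → β) : forceInt n k = k n := by
  cases n <;> simp [forceInt, forceNat_eq]

lemma forceList_eq {β : Type} (l : List (ℤ × ℤ)) (k : List (ℤ × ℤ) → β) :
    forceList l k = k l := by
  induction l generalizing k with
  | nil => rfl
  | cons ε l ih => simp [forceList, forceInt_eq, ih]

lemma split_eq {β : Type} (s : ℤ × ℤ → Bool) (l : List (ℤ × ℤ))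
    (k : List (ℤ × ℤ) → List (ℤ × ℤ) → β) :
    split s l k = k (l.filter s) (l.filter fun ε => !s ε) := by
  induction l generalizing k with
  | nil => rfl
  | cons ε l ih => cases h : s ε <;> simp [split, h, ih]

lemma isUnit_cast_ne_zero (h2 : (2 : F) ≠ 0) {n : ℤ} (h : isUnit n) : (n : F) ≠ 0 := by
  have hn : (n.natAbs : ℤ) ∣ 8 := by
    exact_mod_cast Nat.dvd_of_mod_eq_zero (Nat.eq_of_beq_eq_true h)
  obtain ⟨k, hk⟩ := Int.natAbs_dvd.mp hn
  have h8 : (8 : F) = n * k := by exact_mod_cast congrArg (Int.cast (R := F)) hk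
  intro h0
  rw [h0, zero_mul, show (8 : F) = 2 ^ 3 by norm_num] at h8
  exact h2 (pow_eq_zero_iff (by norm_num) |>.mp h8)

/-- Lagrange interpolation of one value on a set of at most `m + 1` points that can be told apart by
a coordinate over `F`. -/
lemma exists_polyFun_eq_single {s : Finset (ℤ × ℤ)} {m : ℕ} (hs : s.card ≤ m) (δ : ℤ × ℤ)
    (hsep : ∀ ε ∈ s, (δ.1 - ε.1 : F) ≠ 0 ∨ (δ.2 - ε.2 : F) ≠ 0) :
    ∃ f ∈ polyFun F (m + 1), f δ = 1 ∧ ∀ ε ∈ s, f ε = 0 := by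
  classical
  induction s using Finset.induction_on generalizing m with
  | empty => exact ⟨fun _ => 1, const_mem_polyFun m 1, rfl, by simp⟩
  | insert ε s hε ih =>
    rw [Finset.card_insert_of_notMem hε] at hs
    obtain ⟨m, rfl⟩ : ∃ k, m = k + 1 := ⟨m - 1, by omega⟩
    obtain ⟨f, hf, hfδ, hf0⟩ := ih (m := m) (by omega) fun ε hε =>
      hsep ε (Finset.mem_insert_of_mem hε)
    obtain ⟨u, hu⟩ : ∃ u : ℤ × ℤ, affineFun F u (height u 0 ε) δ ≠ 0 := by
      rcases hsep ε (Finset.mem_insert_self _ _) with h | h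
      · exact ⟨(1, 0), by simpa [affineFun, height_eq] using h⟩
      · exact ⟨(0, 1), by simpa [affineFun, height_eq] using h⟩
    refine ⟨(affineFun F u (height u 0 ε) δ)⁻¹ • (affineFun F u (height u 0 ε) * f),
      Submodule.smul_mem _ _ (affineFun_mul_mem hf _ _), ?_, ?_⟩
    · simp [hfδ, hu]
    · intro ε' hε'
      rcases Finset.mem_insert.mp hε' with rfl | h
      · simp [affineFun, height_eq]
      · simp [hf0 ε' h]

theorem interpolates_of_isUnisolvent (h2 : (2 : F) ≠ 0) (m : ℕ) (D : List (ℤ × ℤ))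
    (h : isUnisolvent m D) : Interpolates (polyFun F m) D.toFinset := by
  classical
  induction m generalizing D with
  | zero =>
    obtain rfl : D = [] := by simpa [isUnisolvent] using h
    exact fun φ => ⟨0, Submodule.zero_mem _, by simp⟩
  | succ m ih =>
    rw [isUnisolvent, Bool.or_eq_true] at h
    rcases h with h | h
    · obtain rfl : D = [] := by simpa using h
      exact fun φ => ⟨0, Submodule.zero_mem _, by simp⟩
    simp only [List.any_eq_true, forceInt_eq, split_eq, Bool.and_eq_true] at h
    obtain ⟨u, -, z, -, ⟨⟨⟨hlen, -⟩, hoff⟩, hrec⟩, hon⟩ := h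
    replace hlen := Nat.le_of_ble_eq_true hlen
    generalize height u 0 z = c at *
    set on := D.filter fun ε => isZero (height u c ε)
    set off := D.filter fun ε => !isZero (height u c ε)
    have hcases : ∀ δ ∈ D, δ ∈ on ∨ δ ∈ off := by
      intro δ hδ
      by_cases hd : isZero (height u c δ) = true
      · left; simp [on, hδ, hd]
      · right; simp [off, hδ, hd]
    intro φ
    have hlag : ∀ δ ∈ on, ∃ f ∈ polyFun F (m + 1), f δ = 1 ∧ ∀ ε ∈ on, ε ≠ δ → f ε = 0 := by
      intro δ hδ
      obtain ⟨f, hf, hf1, hf0⟩ := exists_polyFun_eq_single (F := F) (m := m)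
        (s := on.toFinset.erase δ) (by
          rw [Finset.card_erase_of_mem (by simpa using hδ)]
          have := on.toFinset_card_le
          omega) δ (by
          intro ε hε
          obtain ⟨hne, hε⟩ := Finset.mem_erase.mp hε
          have := List.all_eq_true.mp (List.all_eq_true.mp hon δ hδ) ε (by simpa using hε)
          simp only [Bool.or_eq_true, beq_iff_eq] at this
          rcases this with (h | h) | h
          · exact absurd h.symm hne
          · exact Or.inl (by exact_mod_cast isUnit_cast_ne_zero h2 h)
          · exact Or.inr (by exact_mod_cast isUnit_cast_ne_zero h2 h))
      exact ⟨f, hf, hf1, fun ε hε hne => hf0 ε (by simp [hε, hne])⟩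
    choose! f hf hf1 hf0 using hlag
    let g : ℤ × ℤ → F := ∑ δ ∈ on.toFinset, φ δ • f δ
    have hg : g ∈ polyFun F (m + 1) :=
      Submodule.sum_mem _ fun δ hδ => Submodule.smul_mem _ _ (hf δ (by simpa using hδ))
    have hgon : ∀ δ ∈ on, g δ = φ δ := by
      intro δ hδ
      simp only [g, Finset.sum_apply, Pi.smul_apply, smul_eq_mul]
      rw [Finset.sum_eq_single_of_mem δ (by simpa using hδ), hf1 δ hδ, mul_one]
      intro ε hε hne
      rw [hf0 ε (by simpa using hε) δ hδ hne.symm, mul_zero]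
    -- the values off the line are corrected by a multiple of the equation of the line
    obtain ⟨k, hk, hkD⟩ := ih off hrec fun ε =>
      (φ ε - g ε) * (affineFun F u c ε)⁻¹
    refine ⟨affineFun F u c * k + g, Submodule.add_mem _ (affineFun_mul_mem hk _ _) hg, ?_⟩
    intro δ hδ
    rw [Pi.add_apply, Pi.mul_apply]
    rcases hcases δ (by simpa using hδ) with h | h
    · have hd : height u c δ = 0 := isZero_iff.mp (List.mem_filter.mp h).2
      have : affineFun F u c δ = 0 := by
        rw [affineFun, ← height_eq, hd, Int.cast_zero]
      rw [this, zero_mul, zero_add, hgon δ h]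
    · have hne : affineFun F u c δ ≠ 0 :=
        isUnit_cast_ne_zero h2 (List.all_eq_true.mp hoff δ h)
      rw [hkD δ (by simpa using h)]
      field_simp
      ring

lemma injective_of_isUnisolvent (h2 : (2 : F) ≠ 0) {m : ℕ} {D : List (ℤ × ℤ)}
    (h : isUnisolvent m D) : Injective F D.toFinset {m} := by
  refine ⟨{(m, 1, 1)}, rfl, (interpolates_of_isUnisolvent h2 m D h).mono ?_ subset_rfl⟩
  intro f hf
  rw [conds, Multiset.map_singleton, Multiset.sup_singleton]
  refine mem_jets.mpr ⟨f, hf, ?_⟩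
  ext; simp [expo]

/-- A dissection is a list of half-planes `c ≤ w · ε` with multiplicities. Each half-plane cuts off
a part of what the previous ones have left of `D`; the part must determine a point of the given
multiplicity, and nothing may be left at the end. -/
def isDissection : List (ℤ × ℤ) → List (ℤ × ℤ × ℤ × ℕ) → Bool
  | D, [] => D.isEmpty
  | D, (w₁, w₂, c, m) :: l =>
      split (fun ε => isNonneg (height (w₁, w₂) c ε)) D fun P R =>
        isUnisolvent m P && isDissection R l

theorem injective_of_isDissection [Infinite F] (h2 : (2 : F) ≠ 0) (l : List (ℤ × ℤ × ℤ × ℕ))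
    (D : List (ℤ × ℤ)) (h : isDissection D l) :
    Injective F D.toFinset (l.map fun s => s.2.2.2 : List ℕ) := by
  classical
  induction l generalizing D with
  | nil =>
    obtain rfl : D = [] := by simpa [isDissection] using h
    exact ⟨0, rfl, fun φ => ⟨0, Submodule.zero_mem _, by simp⟩⟩
  | cons s l ih =>
    obtain ⟨w₁, w₂, c, m⟩ := s
    rw [isDissection, split_eq, Bool.and_eq_true] at h
    have hglue := (injective_of_isUnisolvent h2 h.1).union (ih _ h.2) (w₁, w₂) (by
      intro δ hδ ε hε
      simp only [List.toFinset_filter, Finset.mem_filter, isNonneg_iff, Bool.not_eq_true',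
        ← Bool.not_eq_true, not_le, height_eq] at hδ hε
      simp only
      omega)
    refine hglue.subset fun ε hε => ?_
    by_cases hc : isNonneg (height (w₁, w₂) c ε) = true
    · exact Finset.mem_union_left _ (by simpa [hc] using hε)
    · exact Finset.mem_union_right _ (by simpa [hc] using hε)

/-! ### Dissections of small rectangles -/

/-- The rectangle of exponents with `W` columns and `H` rows. -/
noncomputable def rect (W H : ℕ) : Finset (ℤ × ℤ) := Finset.Ico 0 (W : ℤ) ×ˢ Finset.Ico 0 (H : ℤ)

lemma mem_rect {W H : ℕ} {ε : ℤ × ℤ} :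
    ε ∈ rect W H ↔ (0 ≤ ε.1 ∧ ε.1 < W) ∧ (0 ≤ ε.2 ∧ ε.2 < H) := by
  simp [rect, Finset.mem_product]

/-- The exponents in a rectangle, as a list. -/
def cells (W H : ℕ) : List (ℤ × ℤ) :=
  (List.range W).flatMap fun a : ℕ => (List.range H).map fun b : ℕ => ((a : ℤ), (b : ℤ))

lemma toFinset_cells (W H : ℕ) : (cells W H).toFinset = rect W H := by
  ext ⟨a, b⟩
  simp only [cells, List.mem_toFinset, List.mem_flatMap, List.mem_map, List.mem_range, mem_rect,
    Prod.mk.injEq]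
  constructor
  · rintro ⟨x, hx, y, hy, rfl, rfl⟩; omega
  · rintro ⟨⟨h1, h2⟩, h3, h4⟩
    exact ⟨a.toNat, by omega, b.toNat, by omega, by omega, by omega⟩

/-- `p` simple, `q` double and `r` triple points in suitable position impose conditions that are
injective on the polynomials with exponents in the rectangle with `W` columns and `H` rows. -/
def RectInjective (F : Type*) [Field F] (W H p q r : ℕ) : Prop :=
  Injective F (rect W H)
    (Multiset.replicate p 1 + (Multiset.replicate q 2 + Multiset.replicate r 3))

/-- Dissections of rectangles with `W` columns and `H` rows into parts for `p` simple, `q` double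
and `r` triple points, labelled by `(W, H, p, q, r)`; here for at most three columns. -/
def dissectionsNarrow : List ((ℕ × ℕ × ℕ × ℕ × ℕ) × List (ℤ × ℤ × ℤ × ℕ)) := [
  ((1, 1, 1, 0, 0), [(1, 0, 0, 1)]),
  ((1, 2, 0, 1, 0), [(1, 0, 0, 2)]),
  ((1, 3, 0, 0, 1), [(1, 0, 0, 3)]),
  ((2, 3, 0, 2, 0), [(1, 1, 2, 2), (1, 0, 0, 2)]),
  ((2, 5, 0, 0, 2), [(-1, -1, -2, 3), (1, 0, 0, 3)]),
  ((2, 4, 0, 1, 1), [(-1, -1, -1, 2), (1, 0, 0, 3)]),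
  ((2, 2, 1, 1, 0), [(-1, -1, -1, 2), (1, 0, 1, 1)]),
  ((2, 2, 0, 0, 1), [(1, 0, 0, 3)]),
  ((2, 3, 1, 0, 1), [(1, -1, 1, 1), (1, 0, 0, 3)]),
  ((3, 4, 0, 0, 2), [(1, 1, 3, 3), (1, 0, 0, 3)]),
  ((3, 3, 0, 1, 1), [(-1, -1, -2, 3), (1, 0, 1, 2)]),
  ((3, 1, 0, 0, 1), [(1, 0, 0, 3)]),
  ((3, 1, 1, 1, 0), [(-1, 0, 0, 1), (1, 0, 1, 2)]),
  ((3, 2, 1, 0, 1), [(1, -1, 2, 1), (1, 0, 0, 3)]),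
  ((3, 2, 3, 1, 0), [(-1, -1, -1, 2), (1, 1, 3, 1), (1, 0, 2, 1), (1, 0, 1, 1)]),
  ((3, 3, 3, 0, 1), [(-1, -1, -2, 3), (1, 1, 4, 1), (1, 0, 2, 1), (1, 0, 1, 1)])]

/-- Dissections of rectangles with four columns. -/
def dissectionsFour : List ((ℕ × ℕ × ℕ × ℕ × ℕ) × List (ℤ × ℤ × ℤ × ℕ)) := [
  ((4, 4, 1, 3, 1), [(-1, -1, -2, 3), (-1, 0, 0, 1), (0, -1, -1, 2), (1, -1, 0, 2), (1, 0, 1, 2)]),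
  ((4, 4, 1, 5, 0), [(1, -1, 3, 1), (-1, 1, 2, 2), (1, 1, 5, 2), (2, -1, 3, 2), (2, -1, 1, 2),
    (1, 0, 0, 2)]),
  ((4, 5, 2, 4, 1), [(-1, -1, -2, 3), (1, 1, 7, 1), (-1, 1, 3, 2), (0, 1, 4, 1), (-1, 1, 1, 2),
    (0, 1, 2, 2), (1, 0, 2, 2)]),
  ((4, 5, 0, 5, 1), [(1, -1, 2, 2), (-1, 1, 3, 2), (-1, -1, -1, 2), (1, -2, -1, 2), (-1, 0, -2, 3),
    (1, 0, 3, 2)]),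
  ((4, 5, 2, 6, 0), [(1, -1, 3, 1), (2, -1, 5, 1), (3, -2, 4, 2), (3, -2, 2, 2), (1, 0, 2, 2),
    (2, -1, 0, 2), (1, -1, -2, 2), (1, 0, 0, 2)]),
  ((4, 5, 0, 7, 0), [(1, 1, 6, 2), (1, -1, 2, 2), (1, 2, 8, 2), (1, 3, 9, 2), (-1, 1, 1, 2),
    (2, -1, 2, 2), (1, 0, 0, 2)]),
  ((4, 6, 0, 6, 1), [(1, -1, 2, 2), (2, -1, 3, 2), (1, -2, -1, 2), (-1, -2, -5, 2), (1, -2, -6, 3),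
    (1, -1, -3, 2), (1, 0, 0, 2)]),
  ((4, 6, 0, 8, 0), [(1, 1, 7, 2), (-1, -1, -1, 2), (2, 1, 8, 2), (-1, -2, -3, 2), (1, 2, 9, 2),
    (-1, 2, 5, 2), (1, 1, 4, 2), (1, 0, 0, 2)])]

/-- Dissections of rectangles with five columns and at most seven rows. -/
def dissectionsFive : List ((ℕ × ℕ × ℕ × ℕ × ℕ) × List (ℤ × ℤ × ℤ × ℕ)) := [
  ((5, 5, 1, 0, 4), [(1, -1, 4, 1), (2, -3, 2, 3), (-1, -2, -5, 3), (2, 1, 8, 3), (1, 0, 0, 3)]),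
  ((5, 5, 1, 2, 3), [(-1, -1, -2, 3), (1, 1, 8, 1), (-1, -2, -4, 2), (3, 2, 14, 3), (1, -1, -2, 3),
    (1, 0, 0, 2)]),
  ((5, 5, 1, 4, 2), [(-1, -1, -2, 3), (1, 1, 8, 1), (-1, -2, -4, 2), (3, 2, 14, 3), (-2, -3, -9, 2),
    (-1, -2, -7, 2), (1, 0, 0, 2)]),
  ((5, 5, 1, 8, 0), [(1, -1, 4, 1), (-1, 1, 3, 2), (1, 1, 7, 2), (1, -2, 2, 2), (3, 1, 11, 2),
    (-2, 1, 1, 2), (-1, 1, 1, 2), (-1, 3, 1, 2), (1, 0, 0, 2)]),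
  ((5, 6, 0, 10, 0), [(1, 1, 8, 2), (-1, -1, -1, 2), (2, 1, 10, 2), (-2, -1, -3, 2),
    (-3, -1, -5, 2), (1, 2, 10, 2), (-1, 1, 1, 2), (1, -1, 3, 2), (0, 1, 2, 2), (1, 0, 2, 2)]),
  ((5, 6, 0, 8, 1), [(1, -1, 3, 2), (2, -1, 5, 2), (2, 1, 9, 3), (1, 2, 10, 2), (1, 2, 8, 2),
    (-1, 1, 2, 2), (2, 1, 5, 2), (1, 1, 2, 2), (1, 0, 0, 2)]),
  ((5, 6, 0, 6, 2), [(1, -1, 3, 2), (2, -1, 5, 2), (2, 1, 9, 3), (-1, 1, 4, 2), (3, -2, 1, 3),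
    (3, -1, 1, 2), (2, -1, -1, 2), (1, 0, 0, 2)]),
  ((5, 6, 0, 4, 3), [(1, -1, 3, 2), (2, -1, 5, 2), (2, 1, 9, 3), (-1, 1, 4, 2), (3, -2, 1, 3),
    (-1, 2, 4, 3), (1, 0, 0, 2)]),
  ((5, 6, 0, 2, 4), [(1, -1, 3, 2), (2, -1, 5, 2), (-1, -1, -2, 3), (-1, 1, 3, 3), (1, -3, -7, 3),
    (1, 0, 1, 3)]),
  ((5, 6, 1, 0, 5), [(1, -1, 4, 1), (2, -3, 2, 3), (1, 1, 7, 3), (1, -2, -2, 3), (1, 3, 12, 3),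
    (1, 0, 0, 3)]),
  ((5, 7, 2, 1, 5), [(-1, -1, -2, 3), (1, 1, 10, 1), (-1, 1, 5, 2), (-3, -1, -7, 3), (-1, 0, -1, 1),
    (-1, 2, 6, 3), (-1, -2, -7, 3), (1, 0, 2, 3)]),
  ((5, 7, 2, 3, 4), [(-1, -1, -2, 3), (1, 1, 10, 1), (-1, 1, 5, 2), (2, 1, 12, 2), (2, 3, 17, 3),
    (-3, -1, -7, 3), (0, 1, 2, 3), (-1, -1, -4, 2), (1, 0, 4, 1)]),
  ((5, 7, 2, 11, 0), [(1, -1, 4, 1), (2, -1, 7, 1), (3, -2, 7, 2), (2, -3, 1, 2), (1, 1, 9, 2),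
    (2, -1, 4, 2), (2, -1, 2, 2), (1, 2, 13, 2), (1, 2, 11, 2), (-1, 2, 7, 2), (1, 1, 4, 2),
    (0, -1, -1, 2), (1, 0, 0, 2)]),
  ((5, 7, 0, 0, 6), [(1, 1, 8, 3), (1, -1, 2, 3), (-1, 2, 8, 3), (-3, 2, 2, 3), (3, -1, 4, 3),
    (1, 0, 0, 3)]),
  ((5, 7, 0, 2, 5), [(1, -1, 3, 2), (2, -1, 4, 3), (1, 1, 9, 2), (-1, -2, -4, 3), (-1, -2, -8, 3),
    (-2, 1, 2, 3), (1, 0, 2, 3)]),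
  ((5, 7, 0, 12, 0), [(1, 1, 9, 2), (-1, 1, 5, 2), (1, 3, 17, 2), (1, 2, 11, 2), (1, -1, 3, 2),
    (2, 1, 9, 2), (3, 2, 12, 2), (20, 1, 41, 2), (3, 1, 6, 2), (-1, -1, -1, 2), (3, 1, 4, 2),
    (1, 0, 0, 2)])]

/-- Dissections of rectangles with five columns and at least eight rows. -/
def dissectionsFiveTall : List ((ℕ × ℕ × ℕ × ℕ × ℕ) × List (ℤ × ℤ × ℤ × ℕ)) := [
  ((5, 8, 1, 1, 6), [(-1, -1, -2, 3), (1, 1, 11, 1), (1, 2, 16, 2), (-1, -3, -7, 3), (3, 2, 18, 3),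
    (1, 3, 16, 3), (1, -1, -1, 3), (1, 0, 0, 3)]),
  ((5, 8, 1, 13, 0), [(1, -1, 4, 1), (-1, 1, 6, 2), (1, 1, 10, 2), (1, -2, 2, 2), (1, 3, 20, 2),
    (-2, 1, 4, 2), (-2, 3, 10, 2), (-1, 3, 10, 2), (1, 1, 7, 2), (2, -3, 2, 2), (1, 1, 5, 2),
    (2, -1, 1, 2), (1, -1, -1, 2), (1, 0, 0, 2)]),
  ((5, 8, 0, 0, 7), [(1, 1, 9, 3), (1, -1, 2, 3), (1, 3, 18, 3), (1, -3, -3, 3), (2, -3, -5, 3),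
    (1, -2, -7, 3), (1, 0, 0, 3)]),
  ((5, 9, 0, 1, 7), [(1, -1, 3, 2), (-1, 1, 6, 3), (1, 2, 16, 3), (-3, 2, 6, 3), (1, -2, 0, 3),
    (3, -2, 2, 3), (0, -1, -3, 3), (1, 0, 1, 3)]),
  ((5, 9, 0, 3, 6), [(1, -1, 3, 2), (2, -1, 5, 2), (-1, 1, 6, 3), (-1, -1, -2, 3), (1, -3, -7, 3),
    (-2, 1, 3, 3), (2, -3, -9, 3), (-3, 2, 4, 3), (1, 0, 3, 2)]),
  ((5, 9, 0, 15, 0), [(1, 1, 11, 2), (-1, -1, -1, 2), (2, 1, 13, 2), (-2, -1, -3, 2),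
    (-3, -1, -5, 2), (-2, -1, -5, 2), (3, 1, 15, 2), (2, 1, 11, 2), (1, 2, 15, 2), (-1, 1, 5, 2),
    (1, 1, 7, 2), (0, 1, 4, 2), (-1, -2, -5, 2), (-2, -1, -8, 2), (1, 0, 3, 2)]),
  ((5, 10, 2, 0, 8), [(1, -1, 4, 1), (2, -1, 7, 1), (-1, -1, -2, 3), (1, -1, 1, 3), (-1, 1, 7, 3),
    (1, 2, 18, 3), (2, 3, 23, 3), (2, 1, 9, 3), (-1, -2, -8, 3), (1, 0, 0, 3)]),
  ((5, 10, 2, 2, 7), [(-1, -1, -2, 3), (1, 1, 13, 1), (-1, 1, 8, 2), (-2, -1, -5, 3),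
    (-1, -2, -7, 3), (-2, -3, -14, 2), (-1, 3, 21, 3), (-3, -1, -11, 3), (0, 1, 8, 1),
    (-1, -1, -8, 3), (1, 0, 2, 3)]),
  ((5, 10, 2, 16, 0), [(1, -1, 4, 1), (2, -1, 7, 1), (3, -2, 7, 2), (2, -3, 1, 2), (1, 1, 12, 2),
    (2, -1, 4, 2), (2, 1, 14, 2), (3, -2, 2, 2), (0, -1, -1, 2), (2, -1, 1, 2), (-1, -1, -3, 2),
    (-1, -2, -9, 2), (-1, -2, -11, 2), (-1, -2, -13, 2), (-2, -3, -23, 2), (0, -1, -7, 2),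
    (-1, -1, -9, 2), (1, 0, 1, 2)]),
  ((5, 10, 0, 1, 8), [(1, -1, 3, 2), (1, -2, 0, 3), (2, -3, -3, 3), (-1, 1, 7, 3), (1, -20, -76, 3),
    (-1, -1, -6, 3), (-1, 3, 20, 3), (-1, -2, -14, 3), (1, 0, 2, 3)]),
  ((5, 10, 0, 17, 0), [(1, 1, 12, 2), (-1, 1, 8, 2), (1, 3, 26, 2), (1, 2, 17, 2), (1, -1, 3, 2),
    (1, -2, 1, 2), (1, -20, -19, 2), (3, 2, 21, 2), (3, 2, 19, 2), (-1, 1, 6, 2), (1, -1, 1, 2),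
    (2, -3, -3, 2), (-2, 1, 4, 2), (-1, -1, -3, 2), (2, -1, 0, 2), (3, -1, 0, 2), (1, 0, 1, 2)]),
  ((5, 11, 1, 0, 9), [(1, -1, 4, 1), (2, -3, 2, 3), (-1, 1, 8, 3), (-1, 3, 23, 3), (-3, 2, 9, 3),
    (1, 2, 16, 3), (-1, -2, -5, 3), (1, 2, 12, 3), (3, 2, 13, 3), (1, 0, 0, 3)]),
  ((5, 11, 1, 2, 8), [(-1, -1, -2, 3), (1, 1, 14, 1), (1, 2, 22, 2), (3, 2, 24, 3), (1, -2, 0, 3),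
    (2, -3, -4, 3), (1, 2, 19, 2), (-1, 2, 13, 3), (1, 3, 19, 3), (-2, 3, 10, 3), (1, 0, 0, 3)]),
  ((5, 12, 0, 0, 10), [(1, 1, 13, 3), (-1, -1, -2, 3), (-1, -3, -7, 3), (1, 3, 30, 3),
    (-2, -3, -13, 3), (2, 3, 28, 3), (-1, 3, 19, 3), (-1, -2, -10, 3), (2, 3, 21, 3),
    (1, 0, 0, 3)]),
  ((5, 12, 0, 2, 9), [(1, -1, 3, 2), (2, -1, 5, 2), (3, -2, 3, 3), (0, -1, -2, 3), (2, -1, 1, 3),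
    (1, -2, -8, 3), (1, 1, 13, 3), (1, -2, -11, 3), (1, 3, 30, 3), (1, -1, -6, 3), (1, 0, 0, 3)]),
  ((5, 13, 2, 1, 10), [(-1, -1, -2, 3), (1, 1, 16, 1), (-1, 1, 11, 2), (2, 1, 19, 1), (-2, 1, 8, 3),
    (-1, -3, -7, 3), (-3, -2, -11, 3), (1, 1, 13, 3), (1, -2, -4, 3), (3, -2, -2, 3),
    (-1, -2, -14, 3), (1, 2, 19, 3), (1, 0, 1, 3)]),
  ((5, 13, 0, 0, 11), [(1, 1, 14, 3), (1, -1, 2, 3), (-1, 2, 20, 3), (1, -3, -3, 3),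
    (-1, -1, -4, 3), (1, -1, -1, 3), (-3, -2, -14, 3), (-2, 3, 24, 3), (-3, -2, -19, 3),
    (-1, 1, 5, 3), (1, 0, 3, 3)]),
  ((5, 13, 0, 2, 10), [(1, -1, 3, 2), (2, -1, 4, 3), (1, 1, 14, 3), (3, -2, 3, 2), (1, 3, 33, 3),
    (0, -1, -2, 3), (2, 3, 31, 3), (1, 20, 161, 3), (2, -1, 1, 3), (3, -2, -5, 3), (1, -2, -11, 3),
    (1, 0, 0, 3)]),
  ((5, 14, 1, 1, 11), [(-1, -1, -2, 3), (1, 1, 17, 1), (1, 2, 28, 2), (-1, -3, -7, 3),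
    (3, 2, 30, 3), (1, 3, 34, 3), (-2, 3, 25, 3), (1, -1, 0, 3), (1, -2, -6, 3), (-1, 3, 22, 3),
    (-1, -2, -12, 3), (-1, -2, -15, 3), (1, 0, 2, 3)]),
  ((5, 14, 0, 0, 12), [(1, 1, 15, 3), (1, -1, 2, 3), (1, 3, 36, 3), (1, -3, -3, 3), (3, 2, 27, 3),
    (3, 2, 24, 3), (2, -1, 2, 3), (3, 1, 13, 3), (3, 2, 18, 3), (1, -2, -6, 3), (-1, -2, -12, 3),
    (1, 0, 0, 3)]),
  ((5, 15, 0, 1, 12), [(1, -1, 3, 2), (-1, 1, 12, 3), (1, 2, 28, 3), (-3, 2, 18, 3), (1, -2, 0, 3),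
    (2, -3, -3, 3), (1, 2, 23, 3), (-1, -2, -8, 3), (-2, -3, -18, 3), (-2, 1, 6, 3), (1, -2, -9, 3),
    (-1, -1, -10, 3), (1, 0, 2, 3)]),
  ((5, 16, 2, 0, 13), [(1, -1, 4, 1), (2, -1, 7, 1), (-1, -1, -2, 3), (1, -1, 1, 3), (-1, 1, 13, 3),
    (1, 2, 30, 3), (2, 3, 41, 3), (-3, -2, -10, 3), (-1, -2, -11, 3), (-1, 1, 10, 3),
    (1, -2, -9, 3), (-1, 3, 27, 3), (2, 3, 30, 3), (1, 1, 9, 3), (1, 0, 0, 3)]),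
  ((5, 16, 2, 2, 12), [(-1, -1, -2, 3), (1, 1, 19, 1), (-1, 1, 14, 2), (-2, -1, -5, 3),
    (-1, -2, -7, 3), (-2, -3, -14, 2), (1, -2, -6, 3), (3, 2, 36, 3), (-3, 2, 22, 3),
    (2, -3, -13, 3), (3, 2, 31, 3), (-3, 1, 10, 1), (1, -2, -12, 3), (1, -3, -23, 3), (-2, 1, 8, 3),
    (1, 0, 1, 3)]),
  ((5, 16, 0, 1, 13), [(1, -1, 3, 2), (1, -2, 0, 3), (2, -3, -3, 3), (-1, 1, 13, 3),
    (1, -20, -76, 3), (-1, 3, 38, 3), (-3, 2, 19, 3), (-1, 2, 20, 3), (3, -2, -2, 3),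
    (-2, 3, 25, 3), (1, -3, -15, 3), (2, -1, -2, 3), (3, -2, -11, 3), (1, 0, 0, 3)]),
  ((5, 18, 0, 0, 15), [(1, 1, 19, 3), (-1, -1, -2, 3), (-1, -3, -7, 3), (1, 3, 48, 3),
    (-2, -3, -13, 3), (2, 3, 46, 3), (-1, 3, 37, 3), (-1, -20, -83, 3), (2, 3, 39, 3),
    (1, 2, 23, 3), (-1, -1, -7, 3), (0, -1, -6, 3), (-1, 2, 17, 3), (-1, 1, 6, 3), (1, 0, 2, 3)])]

/-- Dissections of rectangles with at least six columns. -/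
def dissectionsWide : List ((ℕ × ℕ × ℕ × ℕ × ℕ) × List (ℤ × ℤ × ℤ × ℕ)) := [
  ((6, 6, 0, 6, 3), [(1, -1, 4, 2), (2, -1, 7, 2), (2, 1, 11, 3), (2, -3, 1, 3), (3, 2, 13, 3),
    (0, -1, -1, 2), (1, -1, -1, 2), (0, -1, -3, 2), (1, 0, 0, 2)]),
  ((6, 6, 0, 2, 5), [(1, -1, 4, 2), (2, -1, 7, 2), (-1, -1, -2, 3), (-1, 1, 3, 3), (2, 1, 11, 3),
    (1, -2, -2, 3), (1, 0, 1, 3)]),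
  ((6, 6, 0, 0, 6), [(1, 1, 8, 3), (1, -1, 3, 3), (3, 1, 11, 3), (2, 1, 6, 3), (1, 1, 3, 3),
    (1, 0, 0, 3)]),
  ((6, 7, 0, 4, 5), [(1, -1, 4, 2), (2, -1, 7, 2), (-1, 1, 4, 3), (-1, -1, -2, 3), (-3, 1, -2, 3),
    (1, -1, 2, 2), (1, 1, 9, 3), (0, -1, -2, 2), (1, 0, 2, 3)]),
  ((6, 7, 0, 0, 7), [(1, 1, 9, 3), (-1, -1, -2, 3), (2, 1, 11, 3), (-1, -2, -5, 3), (2, -1, 2, 3),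
    (-1, -1, -5, 3), (1, 0, 0, 3)]),
  ((6, 8, 0, 2, 7), [(1, -1, 4, 2), (2, -1, 7, 2), (3, -2, 6, 3), (-1, -2, -4, 3), (-1, 1, 5, 3),
    (-2, -1, -6, 3), (-2, -1, -9, 3), (3, -2, 1, 3), (1, 0, 2, 3)]),
  ((6, 9, 0, 0, 9), [(1, 1, 11, 3), (-1, -1, -2, 3), (2, 1, 13, 3), (-1, -2, -5, 3), (1, 2, 15, 3),
    (-2, -3, -12, 3), (1, 3, 17, 3), (-1, -2, -9, 3), (1, 0, 0, 3)]),
  ((7, 7, 1, 0, 8), [(1, -1, 6, 1), (2, -3, 6, 3), (1, 1, 10, 3), (-1, 1, 4, 3), (-2, 1, 1, 3),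
    (2, -1, 6, 3), (2, -3, 0, 3), (0, 1, 4, 3), (1, 0, 1, 3)]),
  ((7, 7, 1, 2, 7), [(-1, -1, -2, 3), (1, -1, 4, 3), (1, 1, 10, 3), (1, -3, 0, 2), (3, 1, 16, 3),
    (-1, -3, -8, 2), (1, 1, 9, 1), (3, 1, 12, 3), (1, 2, 10, 3), (1, 0, 0, 3)]),
  ((7, 7, 1, 16, 0), [(1, -1, 6, 1), (-1, 1, 5, 2), (1, 1, 11, 2), (2, -1, 10, 2), (2, 1, 15, 2),
    (2, -1, 8, 2), (3, 1, 18, 2), (-1, 2, 9, 2), (1, 1, 8, 2), (-3, 2, 5, 2), (0, 1, 4, 2),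
    (-1, 2, 4, 2), (-1, 3, 5, 2), (-2, 1, -1, 2), (-2, -1, -5, 2), (1, 1, 5, 2), (1, 0, 2, 2)]),
  ((7, 8, 2, 0, 9), [(1, -1, 6, 1), (2, -1, 11, 1), (-1, -1, -2, 3), (1, 1, 11, 3), (1, 2, 15, 3),
    (-1, 2, 9, 3), (-3, 1, -1, 3), (-3, -2, -12, 3), (1, -3, -2, 3), (1, -1, 1, 3), (1, 0, 2, 3)]),
  ((7, 9, 0, 1, 10), [(1, -1, 5, 2), (-1, 1, 6, 3), (1, 1, 12, 3), (1, -2, 2, 3), (-1, 3, 16, 3),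
    (3, -2, 8, 3), (1, 1, 9, 3), (2, 3, 17, 3), (1, -2, -1, 3), (1, 2, 8, 3), (1, 0, 0, 3)]),
  ((7, 10, 1, 1, 11), [(-1, -1, -2, 3), (1, -1, 4, 3), (1, 1, 13, 3), (2, 1, 16, 3),
    (20, 1, 104, 2), (-1, -3, -8, 3), (2, -1, 4, 3), (2, 3, 28, 3), (-1, -1, -3, 1), (2, -1, 1, 3),
    (3, -2, -5, 3), (0, 1, 7, 3), (1, 0, 0, 3)]),
  ((7, 10, 0, 0, 12), [(1, 1, 13, 3), (1, 2, 19, 3), (3, 2, 25, 3), (-1, -1, -2, 3), (1, -1, 4, 3),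
    (2, 1, 13, 3), (-1, 2, 13, 3), (1, -2, 0, 3), (2, -3, -4, 3), (-1, -1, -5, 3), (-2, 1, 1, 3),
    (1, 0, 2, 3)]),
  ((7, 11, 2, 1, 12), [(-1, -1, -2, 3), (1, -1, 4, 3), (1, 1, 14, 3), (2, 1, 17, 3),
    (-1, -3, -8, 3), (-1, -20, -43, 1), (3, 1, 21, 2), (-1, -1, -3, 1), (1, -2, -3, 3),
    (2, -3, -7, 3), (3, 2, 25, 3), (-1, 2, 16, 3), (1, -2, -8, 3), (1, 2, 15, 3), (1, 0, 0, 3)]),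
  ((7, 11, 0, 0, 13), [(1, 1, 14, 3), (-1, 1, 8, 3), (-1, 3, 22, 3), (-1, -1, -2, 3),
    (-1, 2, 12, 3), (1, -1, 4, 3), (2, 3, 28, 3), (-3, 2, 6, 3), (1, 3, 19, 3), (-2, -1, -6, 3),
    (1, -3, -3, 3), (-1, 2, 4, 3), (1, 0, 3, 3)]),
  ((7, 11, 0, 2, 12), [(1, -1, 5, 2), (-1, 1, 8, 3), (-2, 1, 5, 3), (-1, -1, -1, 2), (1, -2, 2, 3),
    (3, -2, 8, 3), (-3, -2, -8, 3), (1, -2, -3, 3), (-1, -2, -11, 3), (1, -2, -7, 3), (-3, 2, 8, 3),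
    (1, 2, 22, 3), (-1, -2, -18, 3), (1, 0, 3, 3)]),
  ((10, 10, 1, 1, 16), [(-1, -1, -2, 3), (1, -1, 7, 3), (-1, 1, 9, 1), (2, -1, 13, 3),
    (-3, 2, 12, 3), (-2, -1, -5, 3), (-3, -2, -12, 3), (-2, 1, 4, 2), (1, -3, 1, 3), (-3, 2, 6, 3),
    (1, 1, 16, 3), (1, -2, 0, 3), (2, -3, 0, 3), (2, -1, 7, 3), (-3, 1, -4, 3), (1, 1, 13, 3),
    (1, -2, -5, 3), (1, 0, 4, 3)]),
  ((10, 10, 0, 0, 17), [(1, 1, 16, 3), (1, 2, 22, 3), (1, 3, 28, 3), (-2, 3, 19, 3), (1, -1, 7, 3),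
    (2, -1, 13, 3), (3, 2, 32, 3), (2, 1, 17, 3), (1, 2, 16, 3), (2, 1, 14, 3), (20, 1, 101, 3),
    (-3, 2, 7, 3), (-1, -1, -2, 3), (-3, -1, -8, 3), (1, 2, 12, 3), (1, -1, 2, 3), (1, 0, 2, 3)]),
  ((10, 11, 2, 0, 18), [(1, -1, 9, 1), (2, -1, 17, 1), (-1, -1, -2, 3), (1, 1, 17, 3),
    (1, 2, 24, 3), (-1, -2, -5, 3), (3, -2, 20, 3), (2, -3, 7, 3), (2, -3, 4, 3), (2, -1, 10, 3),
    (3, -1, 14, 3), (-2, -3, -13, 3), (1, -3, -8, 3), (-3, -2, -14, 3), (3, -2, 3, 3),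
    (3, 2, 29, 3), (2, 1, 14, 3), (-1, -2, -14, 3), (1, -2, -15, 3), (1, 0, 0, 3)]),
  ((10, 11, 2, 2, 17), [(-1, -1, -2, 3), (1, -1, 7, 3), (-1, 1, 10, 1), (2, -1, 14, 2),
    (3, -1, 21, 2), (-3, 2, 14, 3), (20, -1, 173, 1), (-2, -1, -5, 3), (-1, 2, 15, 3),
    (1, 1, 17, 3), (1, 2, 23, 3), (-2, 1, 3, 3), (-3, -2, -12, 3), (1, 3, 28, 3), (-1, 1, 3, 3),
    (1, 2, 18, 3), (-1, -3, -9, 3), (-1, 3, 10, 3), (-1, -2, -10, 3), (-1, -1, -9, 3),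
    (1, 0, 6, 3)]),
  ((10, 11, 0, 1, 18), [(1, -1, 8, 2), (2, -3, 11, 3), (-1, -1, -2, 3), (2, -3, 8, 3),
    (3, -2, 15, 3), (-1, 1, 8, 3), (-1, 2, 15, 3), (1, -2, 1, 3), (2, -3, 1, 3), (-3, -2, -10, 3),
    (-1, -2, -10, 3), (-2, -1, -9, 3), (-3, -2, -21, 3), (-1, -2, -16, 3), (-1, 3, 22, 3),
    (-1, 1, 3, 3), (2, -1, 9, 3), (2, 1, 21, 3), (1, 0, 5, 3)]),
  ((11, 11, 1, 0, 20), [(1, -1, 10, 1), (2, -3, 14, 3), (1, 1, 18, 3), (-1, 1, 8, 3), (1, 2, 25, 3),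
    (2, -1, 15, 3), (-1, 3, 23, 3), (-3, 2, 9, 3), (3, -2, 18, 3), (-1, 3, 19, 3), (1, 1, 15, 3),
    (3, -1, 18, 3), (2, 3, 30, 3), (3, -1, 15, 3), (3, 1, 19, 3), (1, 2, 13, 3), (2, 3, 17, 3),
    (-1, 1, 2, 3), (2, -3, 4, 3), (-1, 3, 3, 3), (1, 0, 0, 3)]),
  ((11, 11, 1, 2, 19), [(-1, -1, -2, 3), (1, -1, 8, 3), (-1, 1, 10, 1), (2, -1, 15, 3),
    (-3, 2, 14, 3), (3, -1, 22, 3), (20, -1, 174, 2), (-1, 2, 16, 2), (2, -1, 12, 3),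
    (-1, -2, -5, 3), (-2, -3, -12, 3), (-1, 3, 23, 3), (1, -3, -2, 3), (-1, -2, -10, 3),
    (-2, 3, 17, 3), (-2, -3, -20, 3), (-1, -2, -14, 3), (-3, -2, -27, 3), (-2, -3, -31, 3),
    (3, -2, 9, 3), (-2, 1, -5, 3), (1, 0, 7, 3)])]

/-- All the dissections. -/
def dissections : List ((ℕ × ℕ × ℕ × ℕ × ℕ) × List (ℤ × ℤ × ℤ × ℕ)) :=
  dissectionsNarrow ++ (dissectionsFour ++ (dissectionsFive ++ (dissectionsFiveTall ++
    dissectionsWide)))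

/-- The entry of the table is a dissection of the type given by its label. -/
def isValidEntry (x : (ℕ × ℕ × ℕ × ℕ × ℕ) × List (ℤ × ℤ × ℤ × ℕ)) : Bool :=
  (forceList (cells x.1.1 x.1.2.1) fun D => isDissection D x.2) &&
    (x.2.map fun s => s.2.2.2).isPerm (List.replicate x.1.2.2.1 1 ++
      (List.replicate x.1.2.2.2.1 2 ++ List.replicate x.1.2.2.2.2 3))

lemma dissections_valid : ∀ x ∈ dissections, isValidEntry x = true := by
  decide +kernel

lemma rectInjective_of_mem [Infinite F] (h2 : (2 : F) ≠ 0) {W H p q r : ℕ}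
    (h : (W, H, p, q, r) ∈ dissections.map Prod.fst) : RectInjective F W H p q r := by
  obtain ⟨⟨_, l⟩, hx, rfl⟩ := List.mem_map.mp h
  have hv := dissections_valid _ hx
  rw [isValidEntry, forceList_eq, Bool.and_eq_true] at hv
  have := injective_of_isDissection h2 l _ hv.1
  rw [toFinset_cells, Multiset.coe_eq_coe.mpr (List.isPerm_iff.mp hv.2)] at this
  simpa only [RectInjective, ← Multiset.coe_add, Multiset.coe_replicate] using this

/-! ### Operations on rectangles -/

namespace RectInjective

lemma add_simple {W H p q r : ℕ} (h : RectInjective F W H p q r) (k : ℕ) :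
    RectInjective F W H (p + k) q r := by
  induction k with
  | zero => exact h
  | succ k ih =>
    have := Injective.cons ih 1
    rwa [← Multiset.cons_add, ← Multiset.replicate_succ] at this

lemma simple_to_double {W H p q r : ℕ} (k : ℕ) (h : RectInjective F W H (p + k) q r) :
    RectInjective F W H p (q + k) r := by
  induction k generalizing p with
  | zero => exact h
  | succ k ih =>
    have h' := ih (p := p + 1) (by rwa [add_right_comm])
    rw [RectInjective, Multiset.replicate_succ, Multiset.cons_add] at h'
    have := h'.increase (show 1 ≤ 2 by norm_num)
    rwa [← Multiset.add_cons, ← Multiset.cons_add, ← Multiset.replicate_succ] at this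

lemma double_to_triple {W H p q r : ℕ} (k : ℕ) (h : RectInjective F W H p (q + k) r) :
    RectInjective F W H p q (r + k) := by
  induction k generalizing q with
  | zero => exact h
  | succ k ih =>
    have h' := ih (q := q + 1) (by rwa [add_right_comm])
    rw [RectInjective, Multiset.replicate_succ, Multiset.cons_add, Multiset.add_cons] at h'
    have := h'.increase (show 2 ≤ 3 by norm_num)
    rwa [← Multiset.add_cons, ← Multiset.add_cons, ← Multiset.replicate_succ] at this

/-- Increasing multiplicities and adding points preserves injectivity. -/
lemma mono {W H p q r p' q' r' : ℕ} (h : RectInjective F W H p q r) (hr : r ≤ r')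
    (hq : q + r ≤ q' + r') (hp : p + q + r ≤ p' + q' + r') : RectInjective F W H p' q' r' := by
  have h1 := h.add_simple (p' + q' + r' - (p + q + r))
  rw [show p + (p' + q' + r' - (p + q + r)) = p' + (q' + r' - (q + r)) by omega] at h1
  have h2 := h1.simple_to_double
  rw [show q + (q' + r' - (q + r)) = q' + (r' - r) by omega] at h2
  have h3 := h2.double_to_triple
  rwa [show r + (r' - r) = r' by omega] at h3

lemma double_to_simple [Infinite F] {W H p q r : ℕ} (h : RectInjective F W H p (q + 1) r) :
    RectInjective F W H (p + 3) q r := by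
  rw [RectInjective, Multiset.replicate_succ, Multiset.cons_add, Multiset.add_cons] at h
  have := Injective.double_to_simple h
  rwa [← add_assoc, ← Multiset.replicate_add, add_comm 3] at this

lemma of_le {W H W' H' p q r : ℕ} (h : RectInjective F W H p q r) (hW : W' ≤ W) (hH : H' ≤ H) :
    RectInjective F W' H' p q r :=
  Injective.subset h fun ε hε => by rw [mem_rect] at hε ⊢; omega

lemma transpose {W H p q r : ℕ} (h : RectInjective F W H p q r) :
    RectInjective F H W p q r := by
  refine Injective.comp h (0, 1) (1, 0) 0 0 (fun ε hε => ?_) fun ε _ ε' _ heq => ?_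
  · rw [mem_rect] at hε ⊢
    simp only
    omega
  · simp only [Prod.mk.injEq] at heq
    exact Prod.ext (by omega) (by omega)

/-- Cut a rectangle by a horizontal line and distribute the points. -/
lemma stack [Infinite F] {W H H₁ H₂ p₁ q₁ r₁ p₂ q₂ r₂ p q r : ℕ}
    (h₁ : RectInjective F W H₁ p₁ q₁ r₁) (h₂ : RectInjective F W H₂ p₂ q₂ r₂) (hH : H ≤ H₁ + H₂)
    (hr : r₁ + r₂ ≤ r) (hq : q₁ + q₂ + (r₁ + r₂) ≤ q + r)
    (hp : p₁ + p₂ + (q₁ + q₂) + (r₁ + r₂) ≤ p + q + r) : RectInjective F W H p q r := by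
  classical
  have htop : Injective F ((rect W (H₁ + H₂)).filter fun ε => (H₂ : ℤ) ≤ ε.2)
      (Multiset.replicate p₁ 1 + (Multiset.replicate q₁ 2 + Multiset.replicate r₁ 3)) := by
    refine Injective.comp h₁ (1, 0) (0, 1) 0 H₂ (fun ε hε => ?_) fun ε _ ε' _ heq => ?_
    · rw [Finset.mem_filter, mem_rect] at hε
      rw [mem_rect]
      simp only
      push_cast at hε
      omega
    · simp only [Prod.mk.injEq] at heq
      exact Prod.ext (by omega) (by omega)
  have hglue := htop.union h₂ (0, 1) fun δ hδ ε hε => by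
    rw [Finset.mem_filter] at hδ
    rw [mem_rect] at hε
    simp only
    omega
  have hsum : RectInjective F W (H₁ + H₂) (p₁ + p₂) (q₁ + q₂) (r₁ + r₂) := by
    have : Multiset.replicate (p₁ + p₂) 1 +
        (Multiset.replicate (q₁ + q₂) 2 + Multiset.replicate (r₁ + r₂) 3) =
        (Multiset.replicate p₁ 1 + (Multiset.replicate q₁ 2 + Multiset.replicate r₁ 3)) +
        (Multiset.replicate p₂ 1 + (Multiset.replicate q₂ 2 + Multiset.replicate r₂ 3)) := by
      simp only [Multiset.replicate_add]
      abel
    rw [RectInjective, this]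
    refine hglue.subset fun ε hε => ?_
    by_cases hε2 : (H₂ : ℤ) ≤ ε.2
    · exact Finset.mem_union_left _ (Finset.mem_filter.mpr ⟨hε, hε2⟩)
    · refine Finset.mem_union_right _ ?_
      rw [mem_rect] at hε ⊢
      omega
  exact (hsum.of_le le_rfl hH).mono hr hq hp

/-- Cut a rectangle by a vertical line and distribute the points. -/
lemma append [Infinite F] {W W₁ W₂ H p₁ q₁ r₁ p₂ q₂ r₂ p q r : ℕ}
    (h₁ : RectInjective F W₁ H p₁ q₁ r₁) (h₂ : RectInjective F W₂ H p₂ q₂ r₂) (hW : W ≤ W₁ + W₂)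
    (hr : r₁ + r₂ ≤ r) (hq : q₁ + q₂ + (r₁ + r₂) ≤ q + r)
    (hp : p₁ + p₂ + (q₁ + q₂) + (r₁ + r₂) ≤ p + q + r) : RectInjective F W H p q r :=
  (h₁.transpose.stack h₂.transpose hW hr hq hp).transpose

end RectInjective

lemma rectInjective_zero (W p q r : ℕ) : RectInjective F W 0 p q r := by
  have : RectInjective F W 0 0 0 0 := ⟨0, rfl, fun φ => ⟨0, Submodule.zero_mem _, by simp [rect]⟩⟩
  exact this.mono (by omega) (by omega) (by omega)

/-! ### Rectangles with at most three columns -/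

section
variable [Infinite F]

/-- It suffices to treat at most two simple points: three of them may take the place of a double
point. -/
lemma RectInjective.of_mod_three {W H p q r : ℕ} (h : RectInjective F W H (p % 3) (q + p / 3) r) :
    RectInjective F W H p q r := by
  have key : ∀ k a b, RectInjective F W H a (b + k) r → RectInjective F W H (a + 3 * k) b r := by
    intro k
    induction k with
    | zero => exact fun a b h => h
    | succ k ih =>
      intro a b h
      have := ih (a + 3) b (RectInjective.double_to_simple (by rwa [add_assoc]))
      rwa [show a + 3 * (k + 1) = a + 3 + 3 * k by ring]
  have := key (p / 3) (p % 3) q h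
  rwa [Nat.mod_add_div] at this

variable (h2 : (2 : F) ≠ 0)
include h2

theorem rectInjective_one {H p q r : ℕ} (h : H ≤ p + 2 * q + 3 * r) :
    RectInjective F 1 H p q r := by
  induction r generalizing H with
  | succ r ih =>
    exact (rectInjective_of_mem h2 (W := 1) (H := 3) (p := 0) (q := 0) (r := 1) (by decide)).stack
      (ih (H := H - 3) (by omega)) (by omega) (by omega) (by omega) (by omega)
  | zero =>
    induction q generalizing H with
    | succ q ih =>
      exact (rectInjective_of_mem h2 (W := 1) (H := 2) (p := 0) (q := 1) (r := 0) (by decide)).stack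
        (ih (H := H - 2) (by omega)) (by omega) (by omega) (by omega) (by omega)
    | zero =>
      induction p generalizing H with
      | succ p ih =>
        exact (rectInjective_of_mem h2 (W := 1) (H := 1) (p := 1) (q := 0) (r := 0)
          (by decide)).stack (ih (H := H - 1) (by omega))
          (by omega) (by omega) (by omega) (by omega)
      | zero =>
        obtain rfl : H = 0 := by omega
        exact rectInjective_zero 1 0 0 0

theorem rectInjective_simple {W H p q r : ℕ} (h : W * H ≤ p) : RectInjective F W H p q r := by
  suffices RectInjective F W H (W * H) 0 0 from this.mono (by omega) (by omega) (by omega)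
  clear h
  induction W with
  | zero => exact (rectInjective_zero H _ 0 0).transpose
  | succ W ih =>
    have h1 : RectInjective F 1 H H 0 0 := rectInjective_one h2 (by omega)
    have : (W + 1) * H = W * H + H := by ring
    exact ih.append h1 le_rfl (by omega) (by omega) (by omega)

/-- In two columns any two points of multiplicities at most three fill a whole number of rows. -/
theorem rectInjective_two {H p q r : ℕ} (h : 2 * H ≤ p + 3 * q + 5 * r) :
    RectInjective F 2 H p q r := by
  induction hn : p + q + r using Nat.strong_induction_on generalizing H p q r with
  | _ n ih =>
  have T {H p q r : ℕ} :=
    rectInjective_of_mem (F := F) h2 (W := 2) (H := H) (p := p) (q := q) (r := r)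
  rcases Nat.lt_or_ge 1 r with hr | hr
  · exact (T (H := 5) (p := 0) (q := 0) (r := 2) (by decide)).stack
      (ih (p + q + (r - 2)) (by omega) (H := H - 5) (by omega) rfl)
      (by omega) (by omega) (by omega) (by omega)
  rcases Nat.lt_or_ge 1 q with hq | hq
  · exact (T (H := 3) (p := 0) (q := 2) (r := 0) (by decide)).stack
      (ih (p + (q - 2) + r) (by omega) (H := H - 3) (by omega) rfl)
      (by omega) (by omega) (by omega) (by omega)
  rcases Nat.lt_or_ge 1 p with hp | hp
  · exact (rectInjective_simple h2 (W := 2) (H := 1) (p := 2) (q := 0) (r := 0) le_rfl).stack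
      (ih (p - 2 + q + r) (by omega) (H := H - 1) (by omega) rfl)
      (by omega) (by omega) (by omega) (by omega)
  have h1 : RectInjective F 2 1 0 1 0 := (rectInjective_one h2 (by omega)).transpose
  interval_cases r <;> interval_cases q <;> interval_cases p
  · exact (rectInjective_zero 2 0 0 0).of_le le_rfl (by omega)
  · exact (rectInjective_zero 2 1 0 0).of_le le_rfl (by omega)
  · exact h1.of_le le_rfl (by omega)
  · exact (T (H := 2) (p := 1) (q := 1) (r := 0) (by decide)).of_le le_rfl (by omega)
  · exact (T (H := 2) (p := 0) (q := 0) (r := 1) (by decide)).of_le le_rfl (by omega)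
  · exact (T (H := 3) (p := 1) (q := 0) (r := 1) (by decide)).of_le le_rfl (by omega)
  · exact (T (H := 4) (p := 0) (q := 1) (r := 1) (by decide)).of_le le_rfl (by omega)
  · exact ((T (H := 4) (p := 0) (q := 1) (r := 1) (by decide)).add_simple 1).of_le le_rfl
      (by omega)

/-- In three columns two double points fill two rows, two triple points fill four rows, and a double
and a triple point fill three rows. -/
lemma rectInjective_three_of_even {H q r : ℕ} (h : H ≤ q + 2 * r) (heven : 2 ∣ q + r) :
    RectInjective F 3 H 0 q r := by
  induction hn : q + r using Nat.strong_induction_on generalizing H q r with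
  | _ n ih =>
  rcases Nat.lt_or_ge 1 r with hr | hr
  · exact (rectInjective_of_mem h2 (W := 3) (H := 4) (p := 0) (q := 0) (r := 2) (by decide)).stack
      (ih (q + (r - 2)) (by omega) (H := H - 4) (by omega) (by omega) rfl)
      (by omega) (by omega) (by omega) (by omega)
  rcases Nat.lt_or_ge 1 q with hq | hq
  · exact (rectInjective_of_mem h2 (W := 2) (H := 3) (p := 0) (q := 2) (r := 0)
      (by decide)).transpose.stack
      (ih (q - 2 + r) (by omega) (H := H - 2) (by omega) (by omega) rfl)
      (by omega) (by omega) (by omega) (by omega)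
  obtain ⟨rfl, rfl⟩ | ⟨rfl, rfl⟩ : (q = 0 ∧ r = 0) ∨ (q = 1 ∧ r = 1) := by omega
  · exact (rectInjective_zero 3 0 0 0).of_le le_rfl (by omega)
  · exact (rectInjective_of_mem h2 (W := 3) (H := 3) (p := 0) (q := 1) (r := 1)
      (by decide)).of_le le_rfl (by omega)

/-- The parity obstruction is met only when double and triple points alone have to fill the
rectangle exactly: otherwise one of them is combined with simple points, or some conditions may be
given away. -/
theorem rectInjective_three {H p q r : ℕ} (h : 3 * H ≤ p + 3 * q + 6 * r)
    (hex : ¬ (p = 0 ∧ H = q + 2 * r ∧ ¬ 2 ∣ q + r)) : RectInjective F 3 H p q r := by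
  have T {H p q r : ℕ} :=
    rectInjective_of_mem (F := F) h2 (W := 3) (H := H) (p := p) (q := q) (r := r)
  have hsimple : RectInjective F 3 (H - (q + 2 * r)) (3 * (H - (q + 2 * r))) 0 0 :=
    rectInjective_simple h2 le_rfl
  by_cases heven : 2 ∣ q + r
  · exact hsimple.stack (rectInjective_three_of_even h2 le_rfl heven)
      (by omega) (by omega) (by omega) (by omega)
  rcases Nat.eq_zero_or_pos q with rfl | hq
  · have hrest : RectInjective F 3 (2 * (r - 1)) 0 0 (r - 1) :=
      rectInjective_three_of_even h2 (by omega) (by omega)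
    rcases Nat.lt_trichotomy H (0 + 2 * r) with hH | hH | hH
    · exact (T (H := 1) (p := 0) (q := 0) (r := 1) (by decide)).stack hrest
        (by omega) (by omega) (by omega) (by omega)
    · exact (T (H := 2) (p := 1) (q := 0) (r := 1) (by decide)).stack hrest
        (by omega) (by omega) (by omega) (by omega)
    · have hs : RectInjective F 3 (H - 2 * r - 1) (3 * (H - 2 * r - 1)) 0 0 :=
        rectInjective_simple h2 le_rfl
      exact (T (H := 3) (p := 3) (q := 0) (r := 1) (by decide)).stack
        (hs.stack (H := H - 3) (p := p - 3) (q := 0) (r := r - 1) hrest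
          (by omega) (by omega) (by omega) (by omega))
        (by omega) (by omega) (by omega) (by omega)
  · have hrest : RectInjective F 3 (q - 1 + 2 * r) 0 (q - 1) r :=
      rectInjective_three_of_even h2 le_rfl (by omega)
    rcases Nat.lt_trichotomy H (q + 2 * r) with hH | hH | hH
    · exact (hrest.of_le le_rfl (by omega)).mono (by omega) (by omega) (by omega)
    · exact (T (H := 1) (p := 1) (q := 1) (r := 0) (by decide)).stack hrest
        (by omega) (by omega) (by omega) (by omega)
    · have hs : RectInjective F 3 (H - (q + 2 * r) - 1) (3 * (H - (q + 2 * r) - 1)) 0 0 :=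
        rectInjective_simple h2 le_rfl
      exact (T (H := 2) (p := 3) (q := 1) (r := 0) (by decide)).stack
        (hs.stack (H := H - 2) (p := p - 3) (q := q - 1) (r := r) hrest
          (by omega) (by omega) (by omega) (by omega))
        (by omega) (by omega) (by omega) (by omega)

/-! ### Four columns -/

/-- Two triple points fill three rows, and four double points fill three rows. Removing pairs of
triple points leads to one, two or three rows in the end, or to at most one triple point; the
excluded cases are those where the conditions left for these rows are not injective. -/
theorem rectInjective_four {H p q r : ℕ} (hH : 4 ≤ H) (h : 4 * H ≤ p + 3 * q + 6 * r)
    (hex : ¬ (2 ≤ r ∧ ((p = 0 ∧ q = 0 ∧ 2 * H + 1 = 3 * r) ∨ (p ≤ 1 ∧ q = 1 ∧ 2 * H = 3 * r + 2) ∨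
      (p ≤ 2 ∧ q = 0 ∧ 2 * H = 3 * r + 1) ∨ (p = 0 ∧ q = 2 ∧ 2 * H = 3 * r + 3)))) :
    RectInjective F 4 H p q r := by
  have T {H p q r : ℕ} :=
    rectInjective_of_mem (F := F) h2 (W := 4) (H := H) (p := p) (q := q) (r := r)
  induction H using Nat.strong_induction_on generalizing p q r with
  | _ H ih =>
  rcases Nat.lt_or_ge 1 r with hr | hr
  · have hpeel (hrest : RectInjective F 4 (H - 3) p q (r - 2)) : RectInjective F 4 H p q r :=
      (rectInjective_of_mem h2 (W := 3) (H := 4) (p := 0) (q := 0) (r := 2)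
        (by decide)).transpose.stack hrest (by omega) (by omega) (by omega) (by omega)
    apply hpeel
    obtain rfl | rfl | rfl | hH7 : H = 4 ∨ H = 5 ∨ H = 6 ∨ 7 ≤ H := by omega
    · exact (rectInjective_one h2 (by omega)).transpose
    · exact (rectInjective_two h2 (by omega)).transpose
    · exact (rectInjective_three h2 (by omega) (by omega)).transpose
    · exact ih (H - 3) (by omega) (by omega) (by omega) (by omega)
  apply RectInjective.of_mod_three
  obtain ⟨p', hp', hp2⟩ : ∃ p', p' = p % 3 ∧ p' ≤ 2 := ⟨_, rfl, by omega⟩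
  obtain ⟨q', hq'⟩ : ∃ q', q' = q + p / 3 := ⟨_, rfl⟩
  rw [← hp', ← hq']
  replace h : 4 * H ≤ p' + 3 * q' + 6 * r := by omega
  clear hex hp' hq'
  obtain rfl | rfl | rfl | hH7 : H = 4 ∨ H = 5 ∨ H = 6 ∨ 7 ≤ H := by omega
  · rcases Nat.eq_zero_or_pos r with rfl | hr0
    · exact (T (p := 1) (q := 5) (r := 0) (by decide)).mono (by omega) (by omega) (by omega)
    · exact (T (p := 1) (q := 3) (r := 1) (by decide)).mono (by omega) (by omega) (by omega)
  · rcases Nat.eq_zero_or_pos r with rfl | hr0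
    · rcases Nat.lt_or_ge q' 7 with hq7 | hq7
      · exact (T (p := 2) (q := 6) (r := 0) (by decide)).mono (by omega) (by omega) (by omega)
      · exact (T (p := 0) (q := 7) (r := 0) (by decide)).mono (by omega) (by omega) (by omega)
    · rcases Nat.lt_or_ge q' 5 with hq5 | hq5
      · exact (T (p := 2) (q := 4) (r := 1) (by decide)).mono (by omega) (by omega) (by omega)
      · exact (T (p := 0) (q := 5) (r := 1) (by decide)).mono (by omega) (by omega) (by omega)
  · rcases Nat.eq_zero_or_pos r with rfl | hr0
    · exact (T (p := 0) (q := 8) (r := 0) (by decide)).mono (by omega) (by omega) (by omega)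
    · exact (T (p := 0) (q := 6) (r := 1) (by decide)).mono (by omega) (by omega) (by omega)
  · have hblock : RectInjective F 4 3 0 4 0 :=
      (rectInjective_three h2 (by omega) (by omega)).transpose
    exact hblock.stack (ih (H - 3) (by omega) (p := p') (q := q' - 4) (r := r) (by omega) (by omega)
      (by omega)) (by omega) (by omega) (by omega) (by omega)

end

/-! ### Five columns -/

section
variable [Infinite F] (h2 : (2 : F) ≠ 0)
include h2

/-- Blocks of three, six or twelve rows are split off as long as there are points that fill them.
For the small rectangles that remain, and for those where a step would lead to the exceptional case,
a dissection of the whole rectangle is used. -/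
theorem rectInjective_five {H p q r : ℕ} (hH : 5 ≤ H) (h : 5 * H ≤ p + 3 * q + 6 * r)
    (hex : ¬ (H = 6 ∧ p = 0 ∧ q = 0 ∧ r = 5)) : RectInjective F 5 H p q r := by
  have T {H p q r : ℕ} :=
    rectInjective_of_mem (F := F) h2 (W := 5) (H := H) (p := p) (q := q) (r := r)
  induction H using Nat.strong_induction_on generalizing p q r with
  | _ H ih =>
  apply RectInjective.of_mod_three
  obtain ⟨p', hp', hp2⟩ : ∃ p', p' = p % 3 ∧ p' ≤ 2 := ⟨_, rfl, by omega⟩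
  obtain ⟨q', hq'⟩ : ∃ q', q' = q + p / 3 := ⟨_, rfl⟩
  rw [← hp', ← hq']
  replace h : 5 * H ≤ p' + 3 * q' + 6 * r := by omega
  replace hex : ¬ (H = 6 ∧ p' = 0 ∧ q' = 0 ∧ r = 5) := by omega
  clear hp' hq'
  clear p q
  rename' p' => p, q' => q
  -- a triple and three double points fill three rows
  have hpeel (hq : 3 ≤ q) (hr : 1 ≤ r) (hrest : RectInjective F 5 (H - 3) p (q - 3) (r - 1)) :
      RectInjective F 5 H p q r := by
    have hblock : RectInjective F 5 3 0 3 1 :=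
      (rectInjective_three h2 (by omega) (by omega)).transpose
    exact hblock.stack hrest (by omega) (by omega) (by omega) (by omega)
  rcases Nat.lt_or_ge 16 H with hH17 | hH16
  · by_cases hq : 3 ≤ q
    · by_cases hr : 1 ≤ r
      · exact hpeel hq hr (ih (H - 3) (by omega) (by omega) (by omega) (by omega))
      · exact (T (H := 6) (p := 0) (q := 10) (r := 0) (by decide)).stack
          (ih (H - 6) (by omega) (by omega) (p := p) (q := q - 10) (r := r) (by omega) (by omega))
          (by omega) (by omega) (by omega) (by omega)
    · by_cases h18 : H = 18 ∧ p = 0 ∧ q = 0 ∧ r = 15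
      · obtain ⟨rfl, rfl, rfl, rfl⟩ := h18
        exact T (by decide)
      · exact (T (H := 12) (p := 0) (q := 0) (r := 10) (by decide)).stack
          (ih (H - 12) (by omega) (by omega) (p := p) (q := q) (r := r - 10) (by omega) (by omega))
          (by omega) (by omega) (by omega) (by omega)
  by_cases hH7 : 8 ≤ H ∧ 3 ≤ q ∧ 1 ≤ r
  · by_cases h9 : H = 9 ∧ p = 0 ∧ q = 3 ∧ r = 6
    · obtain ⟨rfl, rfl, rfl, rfl⟩ := h9
      exact T (by decide)
    · exact hpeel hH7.2.1 hH7.2.2 (ih (H - 3) (by omega) (by omega) (by omega) (by omega))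
  by_cases hH11 : 11 ≤ H ∧ r = 0
  · exact (T (H := 6) (p := 0) (q := 10) (r := 0) (by decide)).stack
      (ih (H - 6) (by omega) (by omega) (p := p) (q := q - 10) (r := r) (by omega) (by omega))
      (by omega) (by omega) (by omega) (by omega)
  interval_cases H
  · show RectInjective F 5 5 p q r
    obtain h' | h' | h' | h' | h' : (r = 0 ∧ (8 < q ∨ 8 ≤ q ∧ 1 ≤ p)) ∨ (r = 2 ∧ q = 4 ∧ p = 1) ∨
        (r = 3 ∧ q = 2 ∧ 1 ≤ p) ∨ (4 ≤ r ∧ (5 ≤ r ∨ 1 ≤ p + q)) ∨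
        (3 ≤ q ∧ 1 ≤ r ∧ 10 ≤ p + 3 * (q - 3) + 5 * (r - 1)) := by omega
    · exact (T (p := 1) (q := 8) (r := 0) (by decide)).mono (by omega) (by omega) (by omega)
    · exact (T (p := 1) (q := 4) (r := 2) (by decide)).mono (by omega) (by omega) (by omega)
    · exact (T (p := 1) (q := 2) (r := 3) (by decide)).mono (by omega) (by omega) (by omega)
    · exact (T (p := 1) (q := 0) (r := 4) (by decide)).mono (by omega) (by omega) (by omega)
    · exact hpeel h'.1 h'.2.1 (rectInjective_two h2 (by omega)).transpose
  · show RectInjective F 5 6 p q r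
    obtain h' | h' | h' | h' | h' | h' : r = 0 ∨ r = 1 ∨ r = 2 ∨ r = 3 ∨ r = 4 ∨ 5 ≤ r := by omega
    · exact (T (p := 0) (q := 10) (r := 0) (by decide)).mono (by omega) (by omega) (by omega)
    · exact (T (p := 0) (q := 8) (r := 1) (by decide)).mono (by omega) (by omega) (by omega)
    · exact (T (p := 0) (q := 6) (r := 2) (by decide)).mono (by omega) (by omega) (by omega)
    · exact (T (p := 0) (q := 4) (r := 3) (by decide)).mono (by omega) (by omega) (by omega)
    · exact (T (p := 0) (q := 2) (r := 4) (by decide)).mono (by omega) (by omega) (by omega)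
    · exact (T (p := 1) (q := 0) (r := 5) (by decide)).mono (by omega) (by omega) (by omega)
  · show RectInjective F 5 7 p q r
    by_cases h1 : 3 ≤ q ∧ 1 ≤ r
    · by_cases h3 : p = 2 ∧ q = 3 ∧ r = 4
      · obtain ⟨rfl, rfl, rfl⟩ := h3
        exact T (by decide)
      · exact hpeel h1.1 h1.2 (rectInjective_four h2 (by omega) (by omega) (by omega)).transpose
    · obtain h' | h' | h' | h' | h' : (r = 0 ∧ q = 11 ∧ p = 2) ∨ (r = 0 ∧ 12 ≤ q) ∨ 6 ≤ r ∨
          (r = 5 ∧ q = 1 ∧ p = 2) ∨ (r = 5 ∧ q = 2) := by omega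
      · exact (T (p := 2) (q := 11) (r := 0) (by decide)).mono (by omega) (by omega) (by omega)
      · exact (T (p := 0) (q := 12) (r := 0) (by decide)).mono (by omega) (by omega) (by omega)
      · exact (T (p := 0) (q := 0) (r := 6) (by decide)).mono (by omega) (by omega) (by omega)
      · exact (T (p := 2) (q := 1) (r := 5) (by decide)).mono (by omega) (by omega) (by omega)
      · exact (T (p := 0) (q := 2) (r := 5) (by decide)).mono (by omega) (by omega) (by omega)
  · show RectInjective F 5 8 p q r
    obtain h' | h' | h' : r = 0 ∨ r = 6 ∨ 7 ≤ r := by omega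
    · exact (T (p := 1) (q := 13) (r := 0) (by decide)).mono (by omega) (by omega) (by omega)
    · exact (T (p := 1) (q := 1) (r := 6) (by decide)).mono (by omega) (by omega) (by omega)
    · exact (T (p := 0) (q := 0) (r := 7) (by decide)).mono (by omega) (by omega) (by omega)
  · show RectInjective F 5 9 p q r
    obtain h' | h' : r = 0 ∨ 7 ≤ r := by omega
    · exact (T (p := 0) (q := 15) (r := 0) (by decide)).mono (by omega) (by omega) (by omega)
    · exact (T (p := 0) (q := 1) (r := 7) (by decide)).mono (by omega) (by omega) (by omega)
  · show RectInjective F 5 10 p q r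
    obtain h' | h' | h' | h' | h' : (r = 0 ∧ q = 16 ∧ p = 2) ∨ (r = 0 ∧ 17 ≤ q) ∨
        (r = 7 ∧ q = 2 ∧ p = 2) ∨ (r = 8 ∧ q = 0 ∧ p = 2) ∨ (8 ≤ r ∧ 9 ≤ q + r) := by omega
    · exact (T (p := 2) (q := 16) (r := 0) (by decide)).mono (by omega) (by omega) (by omega)
    · exact (T (p := 0) (q := 17) (r := 0) (by decide)).mono (by omega) (by omega) (by omega)
    · exact (T (p := 2) (q := 2) (r := 7) (by decide)).mono (by omega) (by omega) (by omega)
    · exact (T (p := 2) (q := 0) (r := 8) (by decide)).mono (by omega) (by omega) (by omega)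
    · exact (T (p := 0) (q := 1) (r := 8) (by decide)).mono (by omega) (by omega) (by omega)
  · show RectInjective F 5 11 p q r
    obtain h' | h' : r = 8 ∨ 9 ≤ r := by omega
    · exact (T (p := 1) (q := 2) (r := 8) (by decide)).mono (by omega) (by omega) (by omega)
    · exact (T (p := 1) (q := 0) (r := 9) (by decide)).mono (by omega) (by omega) (by omega)
  · show RectInjective F 5 12 p q r
    obtain h' | h' : r = 9 ∨ 10 ≤ r := by omega
    · exact (T (p := 0) (q := 2) (r := 9) (by decide)).mono (by omega) (by omega) (by omega)
    · exact (T (p := 0) (q := 0) (r := 10) (by decide)).mono (by omega) (by omega) (by omega)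
  · show RectInjective F 5 13 p q r
    obtain h' | h' | h' : (r = 10 ∧ q = 1 ∧ p = 2) ∨ (r = 10 ∧ q = 2) ∨ 11 ≤ r := by omega
    · exact (T (p := 2) (q := 1) (r := 10) (by decide)).mono (by omega) (by omega) (by omega)
    · exact (T (p := 0) (q := 2) (r := 10) (by decide)).mono (by omega) (by omega) (by omega)
    · exact (T (p := 0) (q := 0) (r := 11) (by decide)).mono (by omega) (by omega) (by omega)
  · show RectInjective F 5 14 p q r
    obtain h' | h' : r = 11 ∨ 12 ≤ r := by omega
    · exact (T (p := 1) (q := 1) (r := 11) (by decide)).mono (by omega) (by omega) (by omega)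
    · exact (T (p := 0) (q := 0) (r := 12) (by decide)).mono (by omega) (by omega) (by omega)
  · show RectInjective F 5 15 p q r
    exact (T (p := 0) (q := 1) (r := 12) (by decide)).mono (by omega) (by omega) (by omega)
  · show RectInjective F 5 16 p q r
    obtain h' | h' | h' : r = 12 ∨ (r = 13 ∧ q = 0) ∨ (13 ≤ r ∧ 14 ≤ q + r) := by omega
    · exact (T (p := 2) (q := 2) (r := 12) (by decide)).mono (by omega) (by omega) (by omega)
    · exact (T (p := 2) (q := 0) (r := 13) (by decide)).mono (by omega) (by omega) (by omega)
    · exact (T (p := 0) (q := 1) (r := 13) (by decide)).mono (by omega) (by omega) (by omega)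

/-! ### At least six columns and rows -/

/-- A strip of three rows is filled by `q` double and `r` triple points when `q + 2 * r` is its
length and `q + r` is even. -/
lemma rectInjective_strip {W q r : ℕ} (hW : q + 2 * r = W) (h4 : 4 ∣ W + q) :
    RectInjective F W 3 0 q r :=
  (rectInjective_three_of_even h2 hW.ge (by omega)).transpose

lemma rectInjective_six_rows_double {W : ℕ} (hW : 2 ≤ W) : RectInjective F W 6 0 (2 * W) 0 := by
  induction W using Nat.strong_induction_on with
  | _ W ih =>
  have h23 : RectInjective F 2 6 0 4 0 := rectInjective_two h2 (by omega)
  obtain rfl | rfl | hW : W = 2 ∨ W = 3 ∨ 4 ≤ W := by omega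
  · exact h23
  · exact rectInjective_three h2 (by omega) (by omega)
  · exact h23.append (ih (W - 2) (by omega) (by omega)) (by omega) (by omega) (by omega) (by omega)

/-- The rectangles with at least six columns and rows that the general step of
`rectInjective_ge_six` does not reach. -/
lemma rectInjective_small {W H p q r : ℕ} (hW : 6 ≤ W) (hWH : W ≤ H) (hH : H ≤ 11) (hp : p ≤ 2)
    (hq : 9 ≤ H → q ≤ 2) (h : W * H ≤ p + 3 * q + 6 * r)
    (ih : ∀ W' H' p' q' r', 6 ≤ W' → 6 ≤ H' → W' + H' < W + H →
      W' * H' ≤ p' + 3 * q' + 6 * r' → RectInjective F W' H' p' q' r') :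
    RectInjective F W H p q r := by
  have T {W H p q r : ℕ} :=
    rectInjective_of_mem (F := F) h2 (W := W) (H := H) (p := p) (q := q) (r := r)
  have S {W : ℕ} (q r : ℕ) := rectInjective_strip (F := F) h2 (W := W) (q := q) (r := r)
  have hfour {H : ℕ} (p q r : ℕ) :=
    rectInjective_four (F := F) h2 (H := H) (p := p) (q := q) (r := r)
  have hfive {H : ℕ} (p q r : ℕ) :=
    rectInjective_five (F := F) h2 (H := H) (p := p) (q := q) (r := r)
  interval_cases H <;> interval_cases W <;> norm_num at h hq
  · show RectInjective F 6 6 p q r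
    obtain h' | h' | h' | h' | h' | h' | h' :
      r = 0 ∨ r = 1 ∨ r = 2 ∨ r = 3 ∨ r = 4 ∨ r = 5 ∨ 6 ≤ r := by omega
    · exact (S 6 0 (by omega) (by omega)).stack (S 6 0 (by omega) (by omega))
        (by omega) (by omega) (by omega) (by omega)
    · exact (rectInjective_two h2 (H := 6) (p := 0) (q := 4) (r := 0) (by omega)).append
        (hfour 0 6 1 (by omega) (by omega) (by omega)) (by omega) (by omega) (by omega) (by omega)
    · exact (S 6 0 (by omega) (by omega)).stack (S 2 2 (by omega) (by omega))
        (by omega) (by omega) (by omega) (by omega)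
    · exact (T (p := 0) (q := 6) (r := 3) (by decide)).mono (by omega) (by omega) (by omega)
    · exact (S 2 2 (by omega) (by omega)).stack (S 2 2 (by omega) (by omega))
        (by omega) (by omega) (by omega) (by omega)
    · exact (T (p := 0) (q := 2) (r := 5) (by decide)).mono (by omega) (by omega) (by omega)
    · exact (T (p := 0) (q := 0) (r := 6) (by decide)).mono (by omega) (by omega) (by omega)
  · show RectInjective F 6 7 p q r
    obtain h' | h' | h' | h' : r ≤ 2 ∨ (r = 3 ∨ r = 4 ∨ r = 6) ∨ r = 5 ∨ 7 ≤ r := by omega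
    · exact (S 6 0 (by omega) (by omega)).stack
        (hfour p (q - 6) r (by omega) (by omega) (by omega)).transpose
        (by omega) (by omega) (by omega) (by omega)
    · exact (S 2 2 (by omega) (by omega)).stack
        (hfour p (q - 2) (r - 2) (by omega) (by omega) (by omega)).transpose
        (by omega) (by omega) (by omega) (by omega)
    · exact (T (p := 0) (q := 4) (r := 5) (by decide)).mono (by omega) (by omega) (by omega)
    · exact (T (p := 0) (q := 0) (r := 7) (by decide)).mono (by omega) (by omega) (by omega)
  · show RectInjective F 7 7 p q r
    obtain h' | h' | h' | h' | h' : r = 0 ∨ r = 1 ∨ r = 2 ∨ (1 ≤ q ∧ 3 ≤ r ∧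
      ¬ (p = 0 ∧ q = 1 ∧ r = 8) ∧ ¬ (p ≤ 1 ∧ q = 2 ∧ r = 7)) ∨
      ((q = 2 ∧ r = 7 ∧ p = 1) ∨ (8 ≤ r ∧ 9 ≤ p + q + r)) := by omega
    · exact (T (p := 1) (q := 16) (r := 0) (by decide)).mono (by omega) (by omega) (by omega)
    · exact (S 5 1 (by omega) (by omega)).stack
        (hfour p (q - 5) (r - 1) (by omega) (by omega) (by omega)).transpose
        (by omega) (by omega) (by omega) (by omega)
    · exact (S 5 1 (by omega) (by omega)).stack
        (hfour p (q - 5) (r - 1) (by omega) (by omega) (by omega)).transpose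
        (by omega) (by omega) (by omega) (by omega)
    · exact (S 1 3 (by omega) (by omega)).stack
        (hfour p (q - 1) (r - 3) (by omega) (by omega) (by omega)).transpose
        (by omega) (by omega) (by omega) (by omega)
    · obtain h' | h' := h'
      · exact (T (p := 1) (q := 2) (r := 7) (by decide)).mono (by omega) (by omega) (by omega)
      · exact (T (p := 1) (q := 0) (r := 8) (by decide)).mono (by omega) (by omega) (by omega)
  · show RectInjective F 6 8 p q r
    obtain h' | h' | h' | h' : r ≤ 1 ∨ (p = 0 ∧ q = 2 ∧ r = 7) ∨
      (2 ≤ r ∧ 2 ≤ q ∧ ¬ (p = 0 ∧ q = 2 ∧ r = 7)) ∨ 8 ≤ r := by omega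
    · exact (S 6 0 (by omega) (by omega)).stack
        (hfive p (q - 6) r (by omega) (by omega) (by omega)).transpose
        (by omega) (by omega) (by omega) (by omega)
    · exact (T (p := 0) (q := 2) (r := 7) (by decide)).mono (by omega) (by omega) (by omega)
    · exact (S 2 2 (by omega) (by omega)).stack
        (hfive p (q - 2) (r - 2) (by omega) (by omega) (by omega)).transpose
        (by omega) (by omega) (by omega) (by omega)
    · exact (S 0 4 (by omega) (by omega)).transpose.append (S 0 4 (by omega) (by omega)).transpose
        (by omega) (by omega) (by omega) (by omega)
  · show RectInjective F 7 8 p q r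
    obtain h' | h' | h' | h' : r ≤ 1 ∨ (2 ≤ r ∧ r ≤ 3) ∨ (q = 0 ∧ r = 9 ∧ p = 2) ∨
      (4 ≤ r ∧ ¬ (q = 0 ∧ r = 9 ∧ p = 2)) := by omega
    · exact (S 8 0 (by omega) (by omega)).transpose.append
        (hfour p (q - 8) r (by omega) (by omega) (by omega))
        (by omega) (by omega) (by omega) (by omega)
    · exact (S 4 2 (by omega) (by omega)).transpose.append
        (hfour p (q - 4) (r - 2) (by omega) (by omega) (by omega))
        (by omega) (by omega) (by omega) (by omega)
    · exact (T (p := 2) (q := 0) (r := 9) (by decide)).mono (by omega) (by omega) (by omega)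
    · exact (S 0 4 (by omega) (by omega)).transpose.append
        (hfour p q (r - 4) (by omega) (by omega) (by omega))
        (by omega) (by omega) (by omega) (by omega)
  · show RectInjective F 8 8 p q r
    obtain h' | h' | h' : r ≤ 1 ∨ (2 ≤ r ∧ r ≤ 3) ∨ 4 ≤ r := by omega
    · exact (S 8 0 (by omega) (by omega)).transpose.append
        (hfive p (q - 8) r (by omega) (by omega) (by omega))
        (by omega) (by omega) (by omega) (by omega)
    · exact (S 4 2 (by omega) (by omega)).transpose.append
        (hfive p (q - 4) (r - 2) (by omega) (by omega) (by omega))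
        (by omega) (by omega) (by omega) (by omega)
    · exact (S 0 4 (by omega) (by omega)).transpose.append
        (hfive p q (r - 4) (by omega) (by omega) (by omega))
        (by omega) (by omega) (by omega) (by omega)
  · show RectInjective F 6 9 p q r
    by_cases h' : p = 0 ∧ q = 0 ∧ r = 9
    · exact (T (p := 0) (q := 0) (r := 9) (by decide)).mono (by omega) (by omega) (by omega)
    · exact (hfour 0 0 4 (by omega) (by omega) (by omega)).transpose.stack
        (hfive p q (r - 4) (by omega) (by omega) (by omega)).transpose
        (by omega) (by omega) (by omega) (by omega)
  · show RectInjective F 7 9 p q r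
    exact (T (p := 0) (q := 1) (r := 10) (by decide)).mono (by omega) (by omega) (by omega)
  · show RectInjective F 8 9 p q r
    exact (S 0 4 (by omega) (by omega)).stack
      (ih 8 6 p q (r - 4) (by omega) (by omega) (by omega) (by omega))
      (by omega) (by omega) (by omega) (by omega)
  · show RectInjective F 9 9 p q r
    exact (hfour 0 0 6 (by omega) (by omega) (by omega)).transpose.stack
      (hfive p q (r - 6) (by omega) (by omega) (by omega)).transpose
      (by omega) (by omega) (by omega) (by omega)
  · show RectInjective F 6 10 p q r
    exact (hfour 0 0 4 (by omega) (by omega) (by omega)).transpose.stack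
      (ih 6 6 p q (r - 4) (by omega) (by omega) (by omega) (by omega))
      (by omega) (by omega) (by omega) (by omega)
  · show RectInjective F 7 10 p q r
    obtain h' | h' : r = 11 ∨ 12 ≤ r := by omega
    · exact (T (p := 1) (q := 1) (r := 11) (by decide)).mono (by omega) (by omega) (by omega)
    · exact (T (p := 0) (q := 0) (r := 12) (by decide)).mono (by omega) (by omega) (by omega)
  · show RectInjective F 8 10 p q r
    exact (S 0 4 (by omega) (by omega)).stack
      (ih 8 7 p q (r - 4) (by omega) (by omega) (by omega) (by omega))
      (by omega) (by omega) (by omega) (by omega)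
  · show RectInjective F 9 10 p q r
    exact (hfour 0 0 6 (by omega) (by omega) (by omega)).transpose.stack
      (ih 9 6 p q (r - 6) (by omega) (by omega) (by omega) (by omega))
      (by omega) (by omega) (by omega) (by omega)
  · show RectInjective F 10 10 p q r
    obtain h' | h' : r = 16 ∨ 17 ≤ r := by omega
    · exact (T (p := 1) (q := 1) (r := 16) (by decide)).mono (by omega) (by omega) (by omega)
    · exact (T (p := 0) (q := 0) (r := 17) (by decide)).mono (by omega) (by omega) (by omega)
  · show RectInjective F 6 11 p q r
    exact (hfour 0 0 4 (by omega) (by omega) (by omega)).transpose.stack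
      (ih 6 7 p q (r - 4) (by omega) (by omega) (by omega) (by omega))
      (by omega) (by omega) (by omega) (by omega)
  · show RectInjective F 7 11 p q r
    obtain h' | h' | h' : (r = 12 ∧ q = 1 ∧ p = 2) ∨ (r = 12 ∧ q = 2) ∨ 13 ≤ r := by omega
    · exact (T (p := 2) (q := 1) (r := 12) (by decide)).mono (by omega) (by omega) (by omega)
    · exact (T (p := 0) (q := 2) (r := 12) (by decide)).mono (by omega) (by omega) (by omega)
    · exact (T (p := 0) (q := 0) (r := 13) (by decide)).mono (by omega) (by omega) (by omega)
  · show RectInjective F 8 11 p q r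
    exact (S 0 4 (by omega) (by omega)).stack
      (ih 8 8 p q (r - 4) (by omega) (by omega) (by omega) (by omega))
      (by omega) (by omega) (by omega) (by omega)
  · show RectInjective F 9 11 p q r
    exact (hfour 0 0 6 (by omega) (by omega) (by omega)).transpose.stack
      (ih 9 7 p q (r - 6) (by omega) (by omega) (by omega) (by omega))
      (by omega) (by omega) (by omega) (by omega)
  · show RectInjective F 10 11 p q r
    obtain h' | h' | h' : r = 17 ∨ (r = 18 ∧ q = 0) ∨ (18 ≤ r ∧ 19 ≤ q + r) := by omega
    · exact (T (p := 2) (q := 2) (r := 17) (by decide)).mono (by omega) (by omega) (by omega)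
    · exact (T (p := 2) (q := 0) (r := 18) (by decide)).mono (by omega) (by omega) (by omega)
    · exact (T (p := 0) (q := 1) (r := 18) (by decide)).mono (by omega) (by omega) (by omega)
  · show RectInjective F 11 11 p q r
    obtain h' | h' : r = 19 ∨ 20 ≤ r := by omega
    · exact (T (p := 1) (q := 2) (r := 19) (by decide)).mono (by omega) (by omega) (by omega)
    · exact (T (p := 1) (q := 0) (r := 20) (by decide)).mono (by omega) (by omega) (by omega)

/-- With three or more double points a strip of three rows is split off, filled by as many double
points as possible. Otherwise nearly all points are triple and a strip of six rows, filled by triple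
points, is split off. -/
theorem rectInjective_ge_six {W H p q r : ℕ} (hW : 6 ≤ W) (hH : 6 ≤ H)
    (h : W * H ≤ p + 3 * q + 6 * r) : RectInjective F W H p q r := by
  induction hn : W + H using Nat.strong_induction_on generalizing W H p q r with
  | _ n ih =>
  wlog hWH : W ≤ H generalizing W H
  · exact (this hH hW (by rwa [mul_comm]) (by omega) (by omega)).transpose
  subst hn
  apply RectInjective.of_mod_three
  obtain ⟨p', hp', hp2⟩ : ∃ p', p' = p % 3 ∧ p' ≤ 2 := ⟨_, rfl, by omega⟩
  obtain ⟨q', hq'⟩ : ∃ q', q' = q + p / 3 := ⟨_, rfl⟩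
  rw [← hp', ← hq']
  replace h : W * H ≤ p' + 3 * q' + 6 * r := by omega
  clear hp' hq'
  clear p q
  rename' p' => p, q' => q
  by_cases hA : 9 ≤ H ∧ 3 ≤ q
  · obtain ⟨hH9, hq⟩ := hA
    by_cases hodd : W % 2 = 1 ∧ r = 0
    · obtain ⟨hodd, rfl⟩ := hodd
      -- a strip of three rows of odd length cannot be filled by double points alone
      obtain rfl | hH10 : H = 9 ∨ 10 ≤ H := by omega
      · have hcols : RectInjective F 2 9 0 6 0 := rectInjective_two h2 (by omega)
        have hrest : RectInjective F (W - 2) 9 p (q - 6) 0 := by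
          obtain rfl | hW9 : W = 7 ∨ 9 ≤ W := by omega
          · exact rectInjective_five h2 (by omega) (by omega) (by omega)
          · exact ih (W - 2 + 9) (by omega) (by omega) (by omega) (by omega) rfl
        exact hcols.append hrest (by omega) (by omega) (by omega) (by omega)
      · obtain ⟨H', rfl⟩ : ∃ H', H = H' + 6 := ⟨H - 6, by omega⟩
        have hmul : W * (H' + 6) = W * H' + 6 * W := by ring
        have hpos : 6 * 4 ≤ W * H' := Nat.mul_le_mul hW (by omega)
        have hrest : RectInjective F W H' p (q - 2 * W) 0 := by
          obtain rfl | rfl | hH' : H' = 4 ∨ H' = 5 ∨ 6 ≤ H' := by omega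
          · exact (rectInjective_four h2 (by omega) (by omega) (by omega)).transpose
          · exact (rectInjective_five h2 (by omega) (by omega) (by omega)).transpose
          · exact ih (W + H') (by omega) hW hH' (by omega) rfl
        exact (rectInjective_six_rows_double h2 (by omega)).stack hrest
          (by omega) (by omega) (by omega) (by omega)
    · obtain ⟨H', rfl⟩ : ∃ H', H = H' + 3 := ⟨H - 3, by omega⟩
      have hmul : W * (H' + 3) = W * H' + 3 * W := by ring
      have hpos : 6 * W ≤ W * H' := by rw [mul_comm]; exact Nat.mul_le_mul le_rfl (by omega)
      -- as many double points as fit into a strip of three rows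
      obtain ⟨q₁, r₁, hfill, h4, hq₁, hr₁⟩ :
          ∃ q₁ r₁, q₁ + 2 * r₁ = W ∧ 4 ∣ W + q₁ ∧ q₁ ≤ q ∧ r₁ ≤ r := by
        refine ⟨min q W - (min q W + W) % 4, (W - (min q W - (min q W + W) % 4)) / 2,
          ?_, ?_, ?_, ?_⟩ <;>
          rcases Nat.le_total q W with hqW | hqW <;> simp only [hqW, min_eq_left, min_eq_right]
          <;> omega
      exact (rectInjective_strip h2 hfill h4).stack
        (ih (W + H') (by omega) hW (by omega) (p := p) (q := q - q₁) (r := r - r₁) (by omega) rfl)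
        (by omega) (by omega) (by omega) (by omega)
  · by_cases hH12 : 12 ≤ H
    · obtain ⟨H', rfl⟩ : ∃ H', H = H' + 6 := ⟨H - 6, by omega⟩
      have hmul : W * (H' + 6) = W * H' + 6 * W := by ring
      have hpos : 6 * W ≤ W * H' := by rw [mul_comm]; exact Nat.mul_le_mul le_rfl (by omega)
      have hstrip : RectInjective F W 6 0 0 W := ih (W + 6) (by omega) hW le_rfl (by omega) rfl
      exact hstrip.stack
        (ih (W + H') (by omega) hW (by omega) (p := p) (q := q) (r := r - W) (by omega) rfl)
        (by omega) (by omega) (by omega) (by omega)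
    · exact rectInjective_small h2 hW hWH (by omega) hp2 (by omega) h
        fun W' H' p' q' r' h1 h2 h3 h4 => ih (W' + H') h3 h1 h2 h4 rfl

end

end

open MvPolynomial

/-! ### The condition matrix as a specialisation of a matrix of polynomials -/

lemma iterate_pderiv_one {R : Type*} [CommRing R] (i j k : ℕ) :
    (pderiv (1 : Fin 2))^[k] (X 0 ^ i * X 1 ^ j : MvPolynomial (Fin 2) R) =
      C (j.descFactorial k : R) * (X 0 ^ i * X 1 ^ (j - k)) := by
  induction k with
  | zero => simp
  | succ k ih =>
    rw [Function.iterate_succ_apply', ih, Nat.descFactorial_succ]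
    simp only [Derivation.leibniz, Derivation.leibniz_pow, pderiv_C, pderiv_X_self,
      pderiv_X_of_ne (show (0 : Fin 2) ≠ 1 by decide), smul_eq_mul, nsmul_eq_mul, Nat.sub_sub]
    push_cast
    rw [C_mul]
    simp only [map_natCast]
    ring

lemma iterate_pderiv_zero {R : Type*} [CommRing R] (c : R) (i j k : ℕ) :
    (pderiv (0 : Fin 2))^[k] (C c * (X 0 ^ i * X 1 ^ j) : MvPolynomial (Fin 2) R) =
      C (i.descFactorial k : R) * (C c * (X 0 ^ (i - k) * X 1 ^ j)) := by
  induction k with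
  | zero => simp
  | succ k ih =>
    rw [Function.iterate_succ_apply', ih, Nat.descFactorial_succ]
    simp only [Derivation.leibniz, Derivation.leibniz_pow, pderiv_C, pderiv_X_self,
      pderiv_X_of_ne (show (1 : Fin 2) ≠ 0 by decide), smul_eq_mul, nsmul_eq_mul, Nat.sub_sub]
    push_cast
    rw [C_mul]
    simp only [map_natCast]
    ring

lemma derivAt_monomial {F : Type*} [Field F] (P : Fin 2 → F) (a δ : ℕ × ℕ) :
    derivAt P a (X 0 ^ δ.1 * X 1 ^ δ.2) = (δ.1.descFactorial a.1 : F) * δ.2.descFactorial a.2 *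
      (P 0 ^ (δ.1 - a.1) * P 1 ^ (δ.2 - a.2)) := by
  rw [derivAt, iterate_pderiv_one, iterate_pderiv_zero]
  simp
  ring

/-- The matrix of the conditions at given points, in place of the generic ones. -/
noncomputable def pointMatrix {F : Type*} [Field F] {ι : Type} (P : ι → Fin 2 → F)
    (D : Finset (ℕ × ℕ)) (m : ι → ℕ) :
    Matrix (Σ i : ι, {a : ℕ × ℕ // a ∈ orders (m i)}) {δ : ℕ × ℕ // δ ∈ D} F :=
  fun c δ => derivAt (P c.1) c.2.1 (X 0 ^ δ.1.1 * X 1 ^ δ.1.2)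

/-- The matrix of polynomials in the coordinates of the points whose values are the matrices
`pointMatrix`. -/
noncomputable def polyMatrix (K : Type*) [Field K] {ι : Type} (D : Finset (ℕ × ℕ)) (m : ι → ℕ) :
    Matrix (Σ i : ι, {a : ℕ × ℕ // a ∈ orders (m i)}) {δ : ℕ × ℕ // δ ∈ D}
      (MvPolynomial (ι × Fin 2) K) :=
  fun c δ => (δ.1.1.descFactorial c.2.1.1 : MvPolynomial (ι × Fin 2) K) *
    (δ.1.2.descFactorial c.2.1.2 : MvPolynomial (ι × Fin 2) K) *
    (X (c.1, 0) ^ (δ.1.1 - c.2.1.1) * X (c.1, 1) ^ (δ.1.2 - c.2.1.2))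

lemma polyMatrix_map_algebraMap (K : Type*) [Field K] {ι : Type} (D : Finset (ℕ × ℕ))
    (m : ι → ℕ) : (polyMatrix K D m).map (algebraMap _ (RatFun K ι)) = condMatrix K D m := by
  ext c δ
  rw [Matrix.map_apply, condMatrix, derivAt_monomial, polyMatrix]
  simp [basePoint]

lemma polyMatrix_map_aeval {K F : Type*} [Field K] [Field F] [Algebra K F] {ι : Type}
    (P : ι → Fin 2 → F) (D : Finset (ℕ × ℕ)) (m : ι → ℕ) :
    (polyMatrix K D m).map ((aeval fun x : ι × Fin 2 => P x.1 x.2 : _ →ₐ[K] F) : _ →+* F) =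
      pointMatrix P D m := by
  ext c δ
  rw [Matrix.map_apply, pointMatrix, derivAt_monomial, polyMatrix]
  simp

/-! ### Semicontinuity of maximal rank -/

lemma exists_det_submatrix_ne_zero {F : Type*} [Field F] {R C : Type*} [Fintype R] [Fintype C]
    [DecidableEq C] (M : Matrix R C F) (h : M.rank = Fintype.card C) :
    ∃ f : C → R, (M.submatrix f id).det ≠ 0 := by
  obtain ⟨g, hg, -, hli⟩ := Submodule.exists_fun_fin_finrank_span_eq F (Set.range M.row)
  have hcard : Fintype.card C = Module.finrank F (Submodule.span F (Set.range M.row)) := by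
    rw [← Matrix.rank_eq_finrank_span_row, h]
  let e : C ≃ Fin (Module.finrank F (Submodule.span F (Set.range M.row))) :=
    Fintype.equivFinOfCardEq hcard
  choose f hf using fun i => hg i
  refine ⟨f ∘ e, ?_⟩
  have hrows : LinearIndependent F (M.submatrix (f ∘ e) id).row := by
    have h : (M.submatrix (f ∘ e) id).row = _ ∘ e := funext fun i => hf (e i)
    exact h ▸ hli.comp e e.injective
  exact ((Matrix.linearIndependent_rows_iff_isUnit.mp hrows).map Matrix.detMonoidHom).ne_zero

/-- If some specialisation `φ` of a matrix has full column rank, then so has the image of the matrix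
under any injective map `ψ`: a maximal minor that does not vanish under `φ` is nonzero. -/
lemma rank_map_eq_card {A F L : Type*} [CommRing A] [Field F] [Field L] {R C : Type*} [Fintype R]
    [Fintype C] (φ : A →+* F) (ψ : A →+* L) (hψ : Function.Injective ψ) (M : Matrix R C A)
    (h : (M.map φ).rank = Fintype.card C) : (M.map ψ).rank = Fintype.card C := by
  classical
  obtain ⟨f, hf⟩ := exists_det_submatrix_ne_zero _ h
  have hφ : ((M.map φ).submatrix f id).det = φ (M.submatrix f id).det :=
    (RingHom.map_det φ (M.submatrix f id)).symm
  have hψ' : ((M.map ψ).submatrix f id).det = ψ (M.submatrix f id).det :=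
    (RingHom.map_det ψ (M.submatrix f id)).symm
  have hdet : ((M.map ψ).submatrix f id).det ≠ 0 := by
    rw [hψ']
    refine (map_ne_zero_iff ψ hψ).mpr fun h0 => hf ?_
    rw [hφ, h0, map_zero]
  refine le_antisymm (Matrix.rank_le_card_width _) ?_
  rw [← Matrix.rank_of_det_ne_zero hdet]
  exact Matrix.rank_submatrix_le _ _ _

lemma rank_map_eq_card_rows {A F L : Type*} [CommRing A] [Field F] [Field L] {R C : Type*}
    [Fintype R] [Fintype C] (φ : A →+* F) (ψ : A →+* L) (hψ : Function.Injective ψ)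
    (M : Matrix R C A) (h : (M.map φ).rank = Fintype.card R) :
    (M.map ψ).rank = Fintype.card R := by
  have := rank_map_eq_card φ ψ hψ M.transpose
    (by rw [Matrix.transpose_map, Matrix.rank_transpose, h])
  rwa [Matrix.transpose_map, Matrix.rank_transpose] at this

/-! ### From interpolation to the rank of the condition matrix -/

section
variable {F : Type*} [Field F]

/-- Products of falling factorials span the same functions as monomials. -/
lemma monomial_mem_span_descFactorial (m i j : ℕ) (hij : i + j < m) :
    (fun a : ℕ × ℕ => (a.1 : F) ^ i * (a.2 : F) ^ j) ∈ Submodule.span F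
      {f : ℕ × ℕ → F | ∃ α β : ℕ, α + β < m ∧
        f = fun a => (a.1.descFactorial α : F) * a.2.descFactorial β} := by
  have hmul : ∀ n k : ℕ, (n : F) * n.descFactorial k =
      n.descFactorial (k + 1) + k * n.descFactorial k := by
    intro n k
    rw [Nat.descFactorial_succ]
    rcases Nat.lt_or_ge n k with h | h
    · simp [Nat.descFactorial_of_lt h]
    · push_cast [Nat.cast_sub h]; ring
  let S (m : ℕ) := Submodule.span F {f : ℕ × ℕ → F | ∃ α β : ℕ, α + β < m ∧
        f = fun a => (a.1.descFactorial α : F) * a.2.descFactorial β}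
  have hS : ∀ {m α β : ℕ}, α + β < m →
      (fun a : ℕ × ℕ => (a.1.descFactorial α : F) * a.2.descFactorial β) ∈ S m :=
    fun h => Submodule.subset_span ⟨_, _, h, rfl⟩
  have h1 : ∀ m, ∀ f ∈ S m, (fun a => (a.1 : F) * f a) ∈ S (m + 1) := by
    intro m f hf
    induction hf using Submodule.span_induction with
    | mem f hf =>
      obtain ⟨α, β, h, rfl⟩ := hf
      have := Submodule.add_mem _ (hS (m := m + 1) (α := α + 1) (β := β) (by omega))
        (Submodule.smul_mem _ (α : F) (hS (m := m + 1) (α := α) (β := β) (by omega)))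
      convert this using 1
      ext a
      simp only [Pi.add_apply, Pi.smul_apply, smul_eq_mul]
      rw [← mul_assoc, hmul]; ring
    | zero => simp only [Pi.zero_apply, mul_zero]; exact Submodule.zero_mem _
    | add f g _ _ hf hg =>
      convert Submodule.add_mem _ hf hg using 1
      ext a; simp only [Pi.add_apply]; ring
    | smul c f _ hf =>
      convert Submodule.smul_mem _ c hf using 1
      ext a; simp only [Pi.smul_apply, smul_eq_mul]; ring
  have h2 : ∀ m, ∀ f ∈ S m, (fun a => (a.2 : F) * f a) ∈ S (m + 1) := by
    intro m f hf
    induction hf using Submodule.span_induction with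
    | mem f hf =>
      obtain ⟨α, β, h, rfl⟩ := hf
      have := Submodule.add_mem _ (hS (m := m + 1) (α := α) (β := β + 1) (by omega))
        (Submodule.smul_mem _ (β : F) (hS (m := m + 1) (α := α) (β := β) (by omega)))
      convert this using 1
      ext a
      simp only [Pi.add_apply, Pi.smul_apply, smul_eq_mul]
      rw [mul_left_comm, hmul]; ring
    | zero => simp only [Pi.zero_apply, mul_zero]; exact Submodule.zero_mem _
    | add f g _ _ hf hg =>
      convert Submodule.add_mem _ hf hg using 1
      ext a; simp only [Pi.add_apply]; ring
    | smul c f _ hf =>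
      convert Submodule.smul_mem _ c hf using 1
      ext a; simp only [Pi.smul_apply, smul_eq_mul]; ring
  have key : (fun a : ℕ × ℕ => (a.1 : F) ^ i * (a.2 : F) ^ j) ∈ S (1 + j + i) := by
    induction i with
    | zero =>
      induction j with
      | zero => simpa using hS (m := 1) (α := 0) (β := 0) (by omega)
      | succ j ih =>
        have h : (fun a : ℕ × ℕ => (a.1 : F) ^ 0 * (a.2 : F) ^ (j + 1)) =
            fun a => (a.2 : F) * ((a.1 : F) ^ 0 * (a.2 : F) ^ j) := by
          funext a; ring
        exact h ▸ h2 _ _ (ih (by omega))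
    | succ i ih =>
      have h : (fun a : ℕ × ℕ => (a.1 : F) ^ (i + 1) * (a.2 : F) ^ j) =
          fun a => (a.1 : F) * ((a.1 : F) ^ i * (a.2 : F) ^ j) := by
        funext a; ring
      exact h ▸ h1 _ _ (ih (by omega))
  refine Submodule.span_mono ?_ key
  rintro f ⟨α, β, h, rfl⟩
  exact ⟨α, β, by omega, rfl⟩

lemma mem_orders {m : ℕ} {a : ℕ × ℕ} : a ∈ orders m ↔ a.1 + a.2 < m := by
  simp only [orders, Finset.mem_filter, Finset.mem_product, Finset.mem_range]
  omega

/-- The restriction of functions on `ℤ × ℤ` to a set of exponents in `ℕ × ℕ`. -/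
def restrictNat (F : Type*) [Field F] (D : Finset (ℕ × ℕ)) : (ℤ × ℤ → F) →ₗ[F] (D → F) :=
  LinearMap.funLeft F F fun δ => ((δ.1.1 : ℤ), (δ.1.2 : ℤ))

/-- On the exponents in `D`, the jets at a point are combinations of the conditions there. -/
lemma jets_restrict_le {ι : Type} (D : Finset (ℕ × ℕ)) (m : ι → ℕ) (P : ι → Fˣ × Fˣ) (i : ι) :
    (jets (m i, P i)).map (restrictNat F D) ≤ Submodule.span F
      (Set.range (pointMatrix (fun i => ![((P i).1 : F), (P i).2]) D m).row) := by
  rw [jets, ← Submodule.map_comp, Submodule.map_le_iff_le_comap, polyFun, Submodule.span_le]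
  rintro _ ⟨k, l, hkl, rfl⟩
  rw [SetLike.mem_coe, Submodule.mem_comap]
  -- multiplication by the exponential function, restricted to `D`
  let ψ : (ℕ × ℕ → F) →ₗ[F] (D → F) :=
    (LinearMap.mulLeft F fun δ : D => expo (P i) ((δ.1.1 : ℤ), (δ.1.2 : ℤ))) ∘ₗ
      LinearMap.funLeft F F Subtype.val
  have hψ : (restrictNat F D ∘ₗ LinearMap.mulLeft F (expo (P i)))
      (fun ε => (ε.1 : F) ^ k * (ε.2 : F) ^ l) = ψ fun a => (a.1 : F) ^ k * (a.2 : F) ^ l := by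
    ext δ
    simp [ψ, restrictNat, LinearMap.funLeft]
  rw [hψ]
  refine (Submodule.map_le_iff_le_comap.mpr ?_ : Submodule.map ψ _ ≤ _)
    (Submodule.mem_map_of_mem (monomial_mem_span_descFactorial (m i) k l hkl))
  rw [Submodule.span_le]
  rintro _ ⟨α, β, hαβ, rfl⟩
  rw [SetLike.mem_coe, Submodule.mem_comap]
  have hrow := Submodule.smul_mem _ (((P i).1 : F) ^ α * ((P i).2 : F) ^ β)
    (Submodule.subset_span (R := F) (Set.mem_range_self
      (f := (pointMatrix (fun i => ![((P i).1 : F), (P i).2]) D m).row)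
      ⟨i, (α, β), mem_orders.mpr hαβ⟩))
  convert hrow using 1
  ext δ
  have hpow : ∀ (x : F) (n k : ℕ), x ^ k * ((n.descFactorial k : F) * x ^ (n - k)) =
      n.descFactorial k * x ^ n := by
    intro x n k
    rcases Nat.lt_or_ge n k with h | h
    · simp [Nat.descFactorial_of_lt h]
    · rw [mul_left_comm, ← pow_add, Nat.add_sub_cancel' h]
  simp only [Matrix.row, Pi.smul_apply, smul_eq_mul, pointMatrix, derivAt_monomial,
    Matrix.cons_val_zero, Matrix.cons_val_one]
  have e1 := hpow (P i).1 δ.1.1 α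
  have e2 := hpow (P i).2 δ.1.2 β
  calc ψ _ δ = (δ.1.1.descFactorial α * ((P i).1 : F) ^ δ.1.1) *
        (δ.1.2.descFactorial β * ((P i).2 : F) ^ δ.1.2) := by
        simp [ψ, expo, LinearMap.funLeft]; ring
    _ = _ := by rw [← e1, ← e2]; ring

/-- Points with prescribed multiplicities can be labelled by any index type that carries the same
multiplicities. -/
lemma exists_labelling {ι α : Type*} (m : ι → ℕ) (s : Multiset ι) (hs : s.Nodup)
    (c : Multiset (ℕ × α)) [Nonempty α] (h : c.map Prod.fst = s.map m) :
    ∃ P : ι → α, c = s.map fun i => (m i, P i) := by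
  classical
  induction s using Multiset.induction_on generalizing c with
  | empty =>
    obtain rfl : c = 0 := by simpa using h
    exact ⟨fun _ => Classical.arbitrary α, rfl⟩
  | cons i s ih =>
    rw [Multiset.map_cons] at h
    obtain ⟨x, hx, hxm⟩ := Multiset.mem_map.mp (h ▸ Multiset.mem_cons_self (m i) (s.map m))
    obtain ⟨c, rfl⟩ := Multiset.exists_cons_of_mem hx
    rw [Multiset.map_cons, hxm, Multiset.cons_inj_right] at h
    obtain ⟨his, hs⟩ := Multiset.nodup_cons.mp hs
    obtain ⟨P, hP⟩ := ih hs c h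
    refine ⟨Function.update P i x.2, ?_⟩
    rw [Multiset.map_cons, Function.update_self, hP, ← hxm]
    congr 1
    refine Multiset.map_congr rfl fun j hj => ?_
    rw [Function.update_of_ne]
    rintro rfl
    exact his hj

lemma map_mults (p q r : ℕ) :
    (Finset.univ : Finset (Fin p ⊕ (Fin q ⊕ Fin r))).val.map (mults p q r) =
      Multiset.replicate p 1 + (Multiset.replicate q 2 + Multiset.replicate r 3) := by
  rw [← Finset.univ_disjSum_univ, ← Finset.univ_disjSum_univ]
  simp only [mults, Finset.disjSum, Multiset.disjSum, Multiset.map_add, Multiset.map_map,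
    Function.comp_def, Sum.elim_inl, Sum.elim_inr, Multiset.map_const', Finset.card_val,
    Finset.card_univ, Fintype.card_fin]

lemma exists_pointMatrix_rank {d e p q r : ℕ} (h : RectInjective F (d + 1) (e + 1) p q r) :
    ∃ P : Fin p ⊕ (Fin q ⊕ Fin r) → Fin 2 → F,
      (pointMatrix P (rectangle d e) (mults p q r)).rank =
        Fintype.card {δ : ℕ × ℕ // δ ∈ rectangle d e} := by
  obtain ⟨c, hc, hi⟩ := h
  rw [← map_mults] at hc
  obtain ⟨P, rfl⟩ := exists_labelling (mults p q r) _ Finset.univ.nodup c hc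
  refine ⟨fun i => ![((P i).1 : F), (P i).2], ?_⟩
  rw [Matrix.rank_eq_finrank_span_row]
  suffices hspan : Submodule.span F (Set.range (pointMatrix
      (fun i => ![((P i).1 : F), (P i).2]) (rectangle d e) (mults p q r)).row) = ⊤ by
    rw [hspan, finrank_top, Module.finrank_pi]
  rw [eq_top_iff]
  intro φ _
  have hle : (conds (Finset.univ.val.map fun i => (mults p q r i, P i))).map
      (restrictNat F (rectangle d e)) ≤ Submodule.span F (Set.range (pointMatrix
      (fun i => ![((P i).1 : F), (P i).2]) (rectangle d e) (mults p q r)).row) := by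
    rw [Submodule.map_le_iff_le_comap, conds, Multiset.sup_le]
    intro U hU
    simp only [Multiset.map_map, Multiset.mem_map, Function.comp_apply] at hU
    obtain ⟨i, -, rfl⟩ := hU
    exact Submodule.map_le_iff_le_comap.mp (jets_restrict_le _ _ P i)
  obtain ⟨g, hg, hgD⟩ := hi fun ε =>
    if hε : (ε.1.toNat, ε.2.toNat) ∈ rectangle d e then φ ⟨_, hε⟩ else 0
  have : restrictNat F (rectangle d e) g = φ := by
    ext δ
    have hδ := δ.2
    simp only [rectangle, Finset.mem_product, Finset.mem_range] at hδ
    have := hgD ((δ.1.1 : ℤ), (δ.1.2 : ℤ)) (by rw [mem_rect]; simp only; omega)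
    simpa [restrictNat, LinearMap.funLeft] using this
  rw [← this]
  exact hle (Submodule.mem_map_of_mem hg)

end

/-- The function with the values `a`, `b`, `c` on three blocks of `p`, `q`, `r` points. -/
def blocks (p q r a b c : ℕ) : Fin p ⊕ (Fin q ⊕ Fin r) → ℕ :=
  Sum.elim (fun _ => a) (Sum.elim (fun _ => b) (fun _ => c))

lemma card_sigma_blocks (s : ℕ → Finset (ℕ × ℕ)) (p q r a b c : ℕ) :
    Fintype.card (Σ i, {x : ℕ × ℕ // x ∈ s (blocks p q r a b c i)}) =
      p * (s a).card + q * (s b).card + r * (s c).card := by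
  rw [Fintype.card_sigma, Finset.sum_congr rfl fun i _ =>
    Fintype.card_of_subtype (s (blocks p q r a b c i)) fun _ => Iff.rfl]
  simp only [Fintype.sum_sum_type, blocks, Sum.elim_inl, Sum.elim_inr, Finset.sum_const,
    Finset.card_univ, Fintype.card_fin, smul_eq_mul, add_assoc]

lemma card_orders_zero : (orders 0).card = 0 := by decide

lemma card_orders_one : (orders 1).card = 1 := by decide

lemma card_orders_two : (orders 2).card = 3 := by decide

lemma card_orders_three : (orders 3).card = 6 := by decide

lemma card_conditions (p q r : ℕ) :
    Fintype.card (Σ i : Fin p ⊕ (Fin q ⊕ Fin r), {a : ℕ × ℕ // a ∈ orders (mults p q r i)}) =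
      p + 3 * q + 6 * r := by
  have := card_sigma_blocks orders p q r 1 2 3
  rw [card_orders_one, card_orders_two, card_orders_three] at this
  exact this.trans (by ring)

lemma card_exponents (d e : ℕ) :
    Fintype.card {δ : ℕ × ℕ // δ ∈ rectangle d e} = (d + 1) * (e + 1) := by
  rw [Fintype.card_of_subtype (rectangle d e) fun _ => Iff.rfl, rectangle, Finset.card_product,
    Finset.card_range, Finset.card_range]

/-- An extension of `K` in which to choose the points; `K` itself may be finite. -/
abbrev InfiniteExt (K : Type*) [Field K] : Type _ := FractionRing (Polynomial K)

instance (K : Type*) [Field K] : Infinite (InfiniteExt K) :=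
  Infinite.of_injective (algebraMap (Polynomial K) (InfiniteExt K))
    (IsFractionRing.injective _ _)

section
variable {K : Type*} [Field K] {d e p q r : ℕ}

/-- Generic points do as well as the best special choice of points, here in the case of at least as
many conditions as coefficients. -/
theorem not_isSpecial_of_le (h : RectInjective (InfiniteExt K) (d + 1) (e + 1) p q r)
    (hle : (d + 1) * (e + 1) ≤ p + 3 * q + 6 * r) :
    ¬ IsSpecial K (rectangle d e) (mults p q r) := by
  obtain ⟨P, hP⟩ := exists_pointMatrix_rank h
  rw [← polyMatrix_map_aeval (K := K)] at hP
  rw [IsSpecial, not_not, ← polyMatrix_map_algebraMap, card_conditions,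
    rank_map_eq_card _ (algebraMap _ (RatFun K (Fin p ⊕ (Fin q ⊕ Fin r))))
      (IsFractionRing.injective _ _) _ hP, card_exponents, min_eq_right hle]

/-- If the system becomes square and nonsingular on adding simple points, then its conditions are
independent. -/
theorem not_isSpecial_of_square {p' : ℕ} (hp : p ≤ p')
    (h : RectInjective (InfiniteExt K) (d + 1) (e + 1) p' q r)
    (hle : (d + 1) * (e + 1) = p' + 3 * q + 6 * r) :
    ¬ IsSpecial K (rectangle d e) (mults p q r) := by
  obtain ⟨P, hP⟩ := exists_pointMatrix_rank h
  rw [card_exponents, hle, ← card_conditions] at hP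
  have hli : LinearIndependent (InfiniteExt K)
      (pointMatrix P (rectangle d e) (mults p' q r)).row := by
    rw [linearIndependent_iff_card_eq_finrank_span, ← hP, Matrix.rank_eq_finrank_span_row]
    rfl
  let emb : Fin p ⊕ (Fin q ⊕ Fin r) → Fin p' ⊕ (Fin q ⊕ Fin r) := Sum.map (Fin.castLE hp) id
  have hemb : Function.Injective emb :=
    Function.Injective.sumMap (Fin.castLE_injective hp) Function.injective_id
  have hm : ∀ i, mults p' q r (emb i) = mults p q r i := by
    rintro (i | i) <;> rfl
  let embRow : (Σ i, {a : ℕ × ℕ // a ∈ orders (mults p q r i)}) →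
      Σ i, {a : ℕ × ℕ // a ∈ orders (mults p' q r i)} :=
    fun c => ⟨emb c.1, c.2.1, by rw [hm]; exact c.2.2⟩
  have hembRow : Function.Injective embRow := by
    rintro ⟨i, a, ha⟩ ⟨j, b, hb⟩ hab
    simp only [embRow, Sigma.mk.injEq] at hab
    obtain rfl := hemb hab.1
    have := hab.2
    simp only [heq_eq_eq, Subtype.mk.injEq] at this
    subst this
    rfl
  have hrows : LinearIndependent (InfiniteExt K)
      (pointMatrix (P ∘ emb) (rectangle d e) (mults p q r)).row := hli.comp embRow hembRow
  have hrank := hrows.rank_matrix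
  rw [← polyMatrix_map_aeval (K := K)] at hrank
  rw [IsSpecial, not_not, ← polyMatrix_map_algebraMap,
    rank_map_eq_card_rows _ (algebraMap _ (RatFun K (Fin p ⊕ (Fin q ⊕ Fin r))))
      (IsFractionRing.injective _ _) _ hrank, card_conditions, card_exponents,
    min_eq_left (by omega)]

end

section
variable {F : Type*} [Field F]

/-! ### Orders of vanishing -/

/-- The polynomial `f` vanishes to order at least `m` at the point `P`. -/
def Vanishes (P : Fin 2 → F) (m : ℕ) (f : MvPolynomial (Fin 2) F) : Prop :=
  ∀ a ∈ orders m, derivAt P a f = 0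

lemma pderiv_comm (i j : Fin 2) (f : MvPolynomial (Fin 2) F) :
    pderiv i (pderiv j f) = pderiv j (pderiv i f) := by
  have h : ⁅(pderiv i : Derivation F (MvPolynomial (Fin 2) F) (MvPolynomial (Fin 2) F)),
      (pderiv j : Derivation F (MvPolynomial (Fin 2) F) (MvPolynomial (Fin 2) F))⁆ = 0 := by
    refine derivation_ext fun k => ?_
    rw [Derivation.commutator_apply, pderiv_X, pderiv_X]
    simp [Pi.single_apply, apply_ite]
  have := congrArg (fun D : Derivation F _ _ => D f) h
  simpa [Derivation.commutator_apply, sub_eq_zero] using this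

lemma vanishes_succ {P : Fin 2 → F} {m : ℕ} {f : MvPolynomial (Fin 2) F} :
    Vanishes P (m + 1) f ↔
      eval P f = 0 ∧ Vanishes P m (pderiv 0 f) ∧ Vanishes P m (pderiv 1 f) := by
  have h0 : ∀ α β, derivAt P (α, β) (pderiv 0 f) = derivAt P (α + 1, β) f := by
    intro α β
    simp only [derivAt]
    rw [Function.iterate_succ_apply]
    congr 2
    exact Function.Commute.iterate_left (f := pderiv 1) (fun g => pderiv_comm 1 0 g) β f
  have h1 : ∀ α β, derivAt P (α, β) (pderiv 1 f) = derivAt P (α, β + 1) f := fun α β => rfl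
  refine ⟨fun h => ⟨h (0, 0) (mem_orders.mpr (by simp)), ?_, ?_⟩, fun ⟨h, hx, hy⟩ => ?_⟩
  · rintro ⟨α, β⟩ ha
    rw [mem_orders] at ha
    rw [h0]
    exact h _ (mem_orders.mpr (by simp only at ha ⊢; omega))
  · rintro ⟨α, β⟩ ha
    rw [mem_orders] at ha
    rw [h1]
    exact h _ (mem_orders.mpr (by simp only at ha ⊢; omega))
  · rintro ⟨α, β⟩ ha
    rw [mem_orders] at ha
    simp only at ha
    rcases α with - | α
    · rcases β with - | β
      · exact h
      · rw [← h1]; exact hy _ (mem_orders.mpr (by simp only; omega))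
    · rw [← h0]; exact hx _ (mem_orders.mpr (by simp only; omega))

lemma Vanishes.mono {P : Fin 2 → F} {m n : ℕ} {f : MvPolynomial (Fin 2) F} (h : Vanishes P n f)
    (hmn : m ≤ n) : Vanishes P m f :=
  fun a ha => h a (mem_orders.mpr ((mem_orders.mp ha).trans_le hmn))

lemma vanishes_zero (P : Fin 2 → F) (f : MvPolynomial (Fin 2) F) : Vanishes P 0 f :=
  fun _ ha => absurd (mem_orders.mp ha) (Nat.not_lt_zero _)

lemma Vanishes.eval_eq_zero {P : Fin 2 → F} {m : ℕ} {f : MvPolynomial (Fin 2) F}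
    (h : Vanishes P m f) (hm : m ≠ 0) : eval P f = 0 :=
  h (0, 0) (mem_orders.mpr (by simp only; omega))

lemma Vanishes.pderiv {P : Fin 2 → F} {m : ℕ} {f : MvPolynomial (Fin 2) F} (h : Vanishes P m f)
    (i : Fin 2) : Vanishes P (m - 1) (pderiv i f) := by
  rcases m with - | m
  · exact vanishes_zero _ _
  · rw [vanishes_succ] at h
    fin_cases i
    exacts [h.2.1, h.2.2]

lemma Vanishes.add {P : Fin 2 → F} {m : ℕ} {f g : MvPolynomial (Fin 2) F} (hf : Vanishes P m f)
    (hg : Vanishes P m g) : Vanishes P m (f + g) := by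
  intro a ha
  simp only [derivAt, iterate_map_add, map_add]
  rw [← derivAt, ← derivAt, hf a ha, hg a ha, add_zero]

lemma Vanishes.mul {P : Fin 2 → F} {m n : ℕ} {f g : MvPolynomial (Fin 2) F} (hf : Vanishes P m f)
    (hg : Vanishes P n g) : Vanishes P (m + n) (f * g) := by
  obtain ⟨k, hk⟩ : ∃ k, m + n = k := ⟨_, rfl⟩
  rw [hk]
  induction k generalizing m n f g with
  | zero => exact vanishes_zero _ _
  | succ k ih =>
    have hd (i : Fin 2) : Vanishes P k (MvPolynomial.pderiv i (f * g)) := by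
      rw [pderiv_mul]
      refine Vanishes.add ?_ ?_
      · rcases m with - | m
        · exact ih (vanishes_zero P _) (hg.mono (by omega : k ≤ n)) (by omega)
        · exact ih (hf.pderiv i) hg (by omega)
      · rcases n with - | n
        · exact ih (hf.mono (by omega : k ≤ m)) (vanishes_zero P _) (by omega)
        · exact ih hf (hg.pderiv i) (by omega)
    refine vanishes_succ.mpr ⟨?_, hd 0, hd 1⟩
    rw [map_mul]
    rcases Nat.eq_zero_or_pos m with rfl | hm
    · rw [hg.eval_eq_zero (by omega), mul_zero]
    · rw [hf.eval_eq_zero hm.ne', zero_mul]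

/-! ### Linear systems of polynomials of bounded bidegree -/

/-- The polynomial with given coefficients on the exponents in `D`. -/
noncomputable def polyOf (F : Type*) [Field F] (D : Finset (ℕ × ℕ)) :
    (D → F) →ₗ[F] MvPolynomial (Fin 2) F :=
  Fintype.linearCombination F fun δ : D => (X 0 ^ δ.1.1 * X 1 ^ δ.1.2 : MvPolynomial (Fin 2) F)

lemma polyOf_injective (D : Finset (ℕ × ℕ)) : Function.Injective (polyOf F D) := by
  let s : D → (Fin 2 →₀ ℕ) := fun δ => Finsupp.single 0 δ.1.1 + Finsupp.single 1 δ.1.2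
  have hs : Function.Injective s := by
    intro δ ε h
    have h0 := DFunLike.congr_fun h 0
    have h1 := DFunLike.congr_fun h 1
    simp [s] at h0 h1
    exact Subtype.ext (Prod.ext h0 h1)
  have hli := (basisMonomials (Fin 2) F).linearIndependent.comp s hs
  have h : (basisMonomials (Fin 2) F) ∘ s =
      fun δ : D => (X 0 ^ δ.1.1 * X 1 ^ δ.1.2 : MvPolynomial (Fin 2) F) := by
    funext δ
    simp [s, X_pow_eq_monomial, monomial_mul]
  rw [h] at hli
  exact hli.fintypeLinearCombination_injective

/-- The polynomials of degree at most `d` in `X` and at most `e` in `Y`. -/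
noncomputable def bidegree (F : Type*) [Field F] (d e : ℕ) :
    Submodule F (MvPolynomial (Fin 2) F) :=
  LinearMap.range (polyOf F (rectangle d e))

lemma bidegree_eq_span (d e : ℕ) : bidegree F d e =
    Submodule.span F {f | ∃ i j, i ≤ d ∧ j ≤ e ∧ f = X 0 ^ i * X 1 ^ j} := by
  rw [bidegree, polyOf, Fintype.range_linearCombination]
  congr 1
  ext f
  constructor
  · rintro ⟨⟨⟨i, j⟩, h⟩, rfl⟩
    simp only [rectangle, Finset.mem_product, Finset.mem_range] at h
    exact ⟨i, j, by omega, by omega, rfl⟩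
  · rintro ⟨i, j, hi, hj, rfl⟩
    exact ⟨⟨(i, j), by simp only [rectangle, Finset.mem_product, Finset.mem_range]; omega⟩, rfl⟩

lemma mul_mem_bidegree {d e d' e' : ℕ} {f g : MvPolynomial (Fin 2) F} (hf : f ∈ bidegree F d e)
    (hg : g ∈ bidegree F d' e') : f * g ∈ bidegree F (d + d') (e + e') := by
  rw [bidegree_eq_span] at *
  refine Submodule.span_mono ?_ ((Submodule.span_mul_span F
    {f : MvPolynomial (Fin 2) F | ∃ i j, i ≤ d ∧ j ≤ e ∧ f = X 0 ^ i * X 1 ^ j}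
    {f | ∃ i j, i ≤ d' ∧ j ≤ e' ∧ f = X 0 ^ i * X 1 ^ j}).le (Submodule.mul_mem_mul hf hg))
  rintro _ ⟨_, ⟨i, j, hi, hj, rfl⟩, _, ⟨k, l, hk, hl, rfl⟩, rfl⟩
  exact ⟨i + k, j + l, by omega, by omega, by ring⟩

variable {ι : Type}

/-- The linear system of polynomials of bidegree at most `(d, e)` that vanish to order `m i` at the
points `P i`. -/
noncomputable def system [Fintype ι] (P : ι → Fin 2 → F) (d e : ℕ) (m : ι → ℕ) :
    Submodule F (MvPolynomial (Fin 2) F) :=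
  (LinearMap.ker (pointMatrix P (rectangle d e) m).mulVecLin).map (polyOf F (rectangle d e))

lemma derivAt_polyOf (D : Finset (ℕ × ℕ)) (P : Fin 2 → F) (a : ℕ × ℕ) (φ : D → F) :
    derivAt P a (polyOf F D φ) = ∑ δ : D, derivAt P a (X 0 ^ δ.1.1 * X 1 ^ δ.1.2) * φ δ := by
  let T : MvPolynomial (Fin 2) F →ₗ[F] F := (aeval P).toLinearMap ∘ₗ
    ((pderiv 0).toLinearMap ^ a.1) ∘ₗ ((pderiv 1).toLinearMap ^ a.2)
  have hT (f : MvPolynomial (Fin 2) F) : derivAt P a f = T f := by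
    simp [T, derivAt, Module.End.pow_apply, aeval_eq_eval]
  simp only [hT, polyOf, Fintype.linearCombination_apply, map_sum, map_smul, smul_eq_mul, mul_comm]

variable [Fintype ι] {P : ι → Fin 2 → F}

lemma mem_system {d e : ℕ} {m : ι → ℕ} {f : MvPolynomial (Fin 2) F} :
    f ∈ system P d e m ↔ f ∈ bidegree F d e ∧ ∀ i, Vanishes (P i) (m i) f := by
  have h (φ : rectangle d e → F) : (∀ i, Vanishes (P i) (m i) (polyOf F (rectangle d e) φ)) ↔
      (pointMatrix P (rectangle d e) m).mulVecLin φ = 0 := by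
    rw [funext_iff]
    simp only [Vanishes, derivAt_polyOf]
    exact ⟨fun h c => h c.1 c.2.1 c.2.2, fun h i a ha => h ⟨i, a, ha⟩⟩
  constructor
  · rintro ⟨φ, hφ, rfl⟩
    exact ⟨⟨φ, rfl⟩, (h φ).mpr hφ⟩
  · rintro ⟨⟨φ, rfl⟩, hφ⟩
    exact ⟨φ, (h φ).mp hφ, rfl⟩

instance (d e : ℕ) (m : ι → ℕ) : Module.Finite F (system P d e m) :=
  inferInstanceAs (Module.Finite F (Submodule.map _ _))

lemma finrank_system (d e : ℕ) (m : ι → ℕ) : Module.finrank F (system P d e m) +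
    (pointMatrix P (rectangle d e) m).rank = (d + 1) * (e + 1) := by
  rw [system, ← (Submodule.equivMapOfInjective _ (polyOf_injective _) _).finrank_eq, Matrix.rank,
    add_comm,
    LinearMap.finrank_range_add_finrank_ker, Module.finrank_pi, card_exponents]

/-- The dimension of a linear system is at least the number of coefficients minus the number of
conditions. -/
lemma le_finrank_system (d e : ℕ) (m : ι → ℕ) : (d + 1) * (e + 1) ≤
    Module.finrank F (system P d e m) +
      Fintype.card (Σ i : ι, {a : ℕ × ℕ // a ∈ orders (m i)}) := by
  rw [← finrank_system (P := P) d e m]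
  exact Nat.add_le_add_left (Matrix.rank_le_card_height _) _

lemma exists_mem_system {d e : ℕ} {m : ι → ℕ}
    (h : Fintype.card (Σ i : ι, {a : ℕ × ℕ // a ∈ orders (m i)}) < (d + 1) * (e + 1)) :
    ∃ f ∈ system P d e m, f ≠ 0 := by
  refine (Submodule.ne_bot_iff _).mp fun h0 => ?_
  have := le_finrank_system (P := P) d e m
  rw [h0, finrank_bot] at this
  omega

lemma mul_mem_system {d e d' e' : ℕ} {m m' : ι → ℕ} {f g : MvPolynomial (Fin 2) F}
    (hf : f ∈ system P d e m) (hg : g ∈ system P d' e' m') :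
    f * g ∈ system P (d + d') (e + e') (m + m') := by
  rw [mem_system] at *
  exact ⟨mul_mem_bidegree hf.1 hg.1, fun i => (hf.2 i).mul (hg.2 i)⟩

/-- Multiplication by a fixed member of one linear system embeds a second one into a third, whose
matrix therefore has a large kernel. -/
lemma rank_add_le_of_mem_system {d e d' e' : ℕ} {m m' : ι → ℕ} {g : MvPolynomial (Fin 2) F}
    (hg : g ∈ system P d e m) (hg0 : g ≠ 0) (n : ι → ℕ) (hn : n ≤ m + m') :
    (pointMatrix P (rectangle (d + d') (e + e')) n).rank + (d' + 1) * (e' + 1) ≤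
      (d + d' + 1) * (e + e' + 1) +
        Fintype.card (Σ i : ι, {a : ℕ × ℕ // a ∈ orders (m' i)}) := by
  have hmem : ∀ h ∈ system P d' e' m', LinearMap.mulLeft F g h ∈
      system P (d + d') (e + e') n := by
    intro h hh
    have := mul_mem_system hg hh
    rw [mem_system] at this ⊢
    exact ⟨this.1, fun i => (this.2 i).mono (hn i)⟩
  have hle := LinearMap.finrank_le_finrank_of_injective
    (f := (LinearMap.mulLeft F g).restrict hmem) (by
      intro x y hxy
      exact Subtype.ext (mul_left_cancel₀ hg0 (congrArg Subtype.val hxy)))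
  have h1 := finrank_system (P := P) (d + d') (e + e') n
  have h2 := le_finrank_system (P := P) d' e' m'
  omega

/-- A condition that differentiates more than `d` times in `X` is void on the polynomials of degree
at most `d` in `X`. -/
lemma rank_le_card_filter (d e : ℕ) (m : ι → ℕ) : (pointMatrix P (rectangle d e) m).rank ≤
    Fintype.card (Σ i : ι, {a : ℕ × ℕ // a ∈ (orders (m i)).filter fun x : ℕ × ℕ => x.1 ≤ d}) := by
  let M := pointMatrix P (rectangle d e) m
  let v : (Σ i : ι, {a : ℕ × ℕ // a ∈ (orders (m i)).filter fun x : ℕ × ℕ => x.1 ≤ d}) →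
      (rectangle d e → F) := fun c => M.row ⟨c.1, c.2.1, (Finset.mem_filter.mp c.2.2).1⟩
  have hle : Submodule.span F (Set.range M.row) ≤ Submodule.span F (Set.range v) := by
    rw [Submodule.span_le]
    rintro _ ⟨⟨i, a, ha⟩, rfl⟩
    by_cases hd : a.1 ≤ d
    · exact Submodule.subset_span ⟨⟨i, a, Finset.mem_filter.mpr ⟨ha, hd⟩⟩, rfl⟩
    · have h0 : M.row ⟨i, a, ha⟩ = 0 := by
        funext δ
        have hδ := δ.2
        simp only [rectangle, Finset.mem_product, Finset.mem_range] at hδ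
        simp only [M, Matrix.row, pointMatrix, derivAt_monomial, Pi.zero_apply]
        rw [Nat.descFactorial_of_lt (by omega : δ.1.1 < a.1)]
        simp
      rw [h0]
      exact Submodule.zero_mem _
  rw [Matrix.rank_eq_finrank_span_row]
  exact (Submodule.finrank_mono hle).trans (finrank_range_le_card v)

end

/-! ### The special systems -/

section
variable {K : Type*} [Field K] {d e p q r : ℕ}

lemma isSpecial_of_rank_lt (h : (condMatrix K (rectangle d e) (mults p q r)).rank <
    p + 3 * q + 6 * r) (h' : (condMatrix K (rectangle d e) (mults p q r)).rank <
    (d + 1) * (e + 1)) : IsSpecial K (rectangle d e) (mults p q r) := by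
  rw [IsSpecial, card_conditions, card_exponents]
  omega

theorem isSpecial_zero (h : p + 2 * q + 3 * r ≤ e) (hqr : 1 ≤ q ∨ 1 ≤ r) :
    IsSpecial K (rectangle 0 e) (mults p q r) := by
  have h1 : (condMatrix K (rectangle 0 e) (mults p q r)).rank ≤ p * 1 + q * 2 + r * 3 :=
    (rank_le_card_filter 0 e _).trans
      (card_sigma_blocks (fun m => (orders m).filter fun x : ℕ × ℕ => x.1 ≤ 0) p q r 1 2 3).le
  apply isSpecial_of_rank_lt <;> omega

theorem isSpecial_one (h : p + 3 * q + 5 * r ≤ 2 * e + 1) (hr : 1 ≤ r) :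
    IsSpecial K (rectangle 1 e) (mults p q r) := by
  have h1 : (condMatrix K (rectangle 1 e) (mults p q r)).rank ≤ p * 1 + q * 3 + r * 5 :=
    (rank_le_card_filter 1 e _).trans
      (card_sigma_blocks (fun m => (orders m).filter fun x : ℕ × ℕ => x.1 ≤ 1) p q r 1 2 3).le
  apply isSpecial_of_rank_lt <;> omega

lemma blocks_le {a b c a' b' c' : ℕ} (h : a ≤ a' ∧ b ≤ b' ∧ c ≤ c') :
    blocks p q r a b c ≤ blocks p q r a' b' c' := by
  rintro (i | i | i)
  exacts [h.1, h.2.1, h.2.2]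

lemma blocks_add (a b c a' b' c' : ℕ) : blocks p q r a b c + blocks p q r a' b' c' =
    blocks p q r (a + a') (b + b') (c + c') := by
  funext i
  rcases i with i | i | i <;> rfl

lemma exists_mem_system_blocks (a b c : ℕ)
    (h : p * (orders a).card + q * (orders b).card + r * (orders c).card < (d + 1) * (e + 1)) :
    ∃ f ∈ system (basePoint K) d e (blocks p q r a b c), f ≠ 0 :=
  exists_mem_system ((card_sigma_blocks orders p q r a b c).trans_lt h)

/-- The linear system of bidegree `(d, e)` is special as soon as it contains all products of a fixed
polynomial `g` with the members of a linear system whose expected dimension is positive and exceeds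
the one of the whole system. -/
lemma isSpecial_of_mem_system {a b c d₁ e₁ : ℕ} {g : MvPolynomial (Fin 2) _}
    (hg : g ∈ system (basePoint K) d₁ e₁ (blocks p q r a b c)) (hg0 : g ≠ 0) (d₂ e₂ a' b' c' : ℕ)
    (hm : 1 ≤ a + a' ∧ 2 ≤ b + b' ∧ 3 ≤ c + c') (hd : d₁ + d₂ = d) (he : e₁ + e₂ = e)
    (h : p * (orders a').card + q * (orders b').card + r * (orders c').card <
      (d₂ + 1) * (e₂ + 1))
    (h' : (d + 1) * (e + 1) +
        (p * (orders a').card + q * (orders b').card + r * (orders c').card) <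
      p + 3 * q + 6 * r + (d₂ + 1) * (e₂ + 1)) :
    IsSpecial K (rectangle d e) (mults p q r) := by
  subst hd he
  have hle := rank_add_le_of_mem_system (d' := d₂) (e' := e₂) (m' := blocks p q r a' b' c') hg hg0
    (mults p q r) (blocks_add a b c a' b' c' ▸ blocks_le hm)
  have hcard := card_sigma_blocks orders p q r a' b' c'
  have hM : (condMatrix K (rectangle (d₁ + d₂) (e₁ + e₂)) (mults p q r)).rank =
    (pointMatrix (basePoint K) (rectangle (d₁ + d₂) (e₁ + e₂)) (mults p q r)).rank := rfl
  apply isSpecial_of_rank_lt <;> omega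

/-- The products of a curve of bidegree `(1, k)` through all points, the horizontal lines through
the triple points, and another curve of bidegree `(1, k)` through all points. -/
theorem isSpecial_two (he : e + 1 = q + 2 * r) (hqr : ¬ 2 ∣ q + r) :
    IsSpecial K (rectangle 2 e) (mults 0 q r) := by
  obtain ⟨k, hk⟩ : ∃ k, q + r = 2 * k + 1 := ⟨(q + r) / 2, by omega⟩
  obtain ⟨f, hf, hf0⟩ := exists_mem_system_blocks (K := K) (p := 0) (q := q) (r := r) (d := 1)
    (e := k) 1 1 1 (by simp only [card_orders_one]; omega)
  obtain ⟨l, hl, hl0⟩ := exists_mem_system_blocks (K := K) (p := 0) (q := q) (r := r) (d := 0)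
    (e := r) 0 0 1 (by simp only [card_orders_one, card_orders_zero]; omega)
  have hg := mul_mem_system hf hl
  rw [blocks_add] at hg
  refine isSpecial_of_mem_system hg (mul_ne_zero hf0 hl0) 1 k 1 1 1 (by omega) (by omega)
    (by omega) ?_ ?_ <;> simp only [card_orders_one] <;> omega

/-- The products of the square of a curve of bidegree `(1, k)` through the double and triple points
with the curves of bidegree `(1, e₂)` through the simple and triple points. -/
lemma isSpecial_of_square (k e₂ : ℕ) (hk : q + r ≤ 2 * k + 1) (he : 2 * k + e₂ = e)
    (h : p + r < 2 * (e₂ + 1)) (h' : 4 * (e + 1) < 3 * q + 5 * r + 2 * (e₂ + 1)) :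
    IsSpecial K (rectangle 3 e) (mults p q r) := by
  obtain ⟨f, hf, hf0⟩ := exists_mem_system_blocks (K := K) (p := p) (q := q) (r := r) (d := 1)
    (e := k) 0 1 1 (by simp only [card_orders_one, card_orders_zero]; omega)
  have hg := mul_mem_system hf hf
  rw [blocks_add] at hg
  refine isSpecial_of_mem_system hg (mul_ne_zero hf0 hf0) 1 e₂ 1 0 1 (by omega) (by omega)
    (by omega) ?_ ?_ <;> simp only [card_orders_one, card_orders_zero] <;> omega

theorem isSpecial_three {n : ℕ}
    (h : (e = 3 * n ∧ p = 0 ∧ q = 0 ∧ r = 2 * n + 1) ∨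
      (e = 3 * n ∧ p ≤ 1 ∧ q = 1 ∧ r = 2 * n) ∨
      (e = 3 * n + 1 ∧ p ≤ 2 ∧ q = 0 ∧ r = 2 * n + 1) ∨
      (e = 3 * n + 2 ∧ p = 0 ∧ q = 2 ∧ r = 2 * n + 1)) :
    IsSpecial K (rectangle 3 e) (mults p q r) := by
  rcases h with h | h | h | h
  · exact isSpecial_of_square n n (by omega) (by omega) (by omega) (by omega)
  · exact isSpecial_of_square n n (by omega) (by omega) (by omega) (by omega)
  · exact isSpecial_of_square n (n + 1) (by omega) (by omega) (by omega) (by omega)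
  · exact isSpecial_of_square (n + 1) n (by omega) (by omega) (by omega) (by omega)

/-- The products of a curve of bidegree `(1, 2)` through the five points with a curve of bidegree
`(3, 3)` that has multiplicity two at each of them. -/
theorem isSpecial_four : IsSpecial K (rectangle 4 5) (mults 0 0 5) := by
  obtain ⟨f, hf, hf0⟩ := exists_mem_system_blocks (K := K) (p := 0) (q := 0) (r := 5) (d := 1)
    (e := 2) 0 0 1 (by simp only [card_orders_one]; omega)
  refine isSpecial_of_mem_system hf hf0 3 3 1 2 2 (by omega) (by omega)
    (by omega) ?_ ?_ <;> simp only [card_orders_two] <;> omega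

end

/-! ### The classification -/

/-- Outside the list, the conditions become injective as soon as enough simple points are added for
them to be at least as many as the coefficients. -/
lemma rectInjective_of_not_exceptional {F : Type*} [Field F] [Infinite F] (h2 : (2 : F) ≠ 0)
    {d e p q r p' : ℕ} (hde : d ≤ e)
    (h0 : ¬ (d = 0 ∧ p + 2 * q + 3 * r ≤ e ∧ (1 ≤ q ∨ 1 ≤ r)))
    (h1 : ¬ (d = 1 ∧ p + 3 * q + 5 * r ≤ 2 * e + 1 ∧ 1 ≤ r))
    (h3 : ¬ (d = 2 ∧ p = 0 ∧ e + 1 = q + 2 * r ∧ ¬ 2 ∣ q + r))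
    (h4 : ¬ (d = 3 ∧ ∃ n : ℕ, 1 ≤ n ∧
        ((e = 3 * n ∧ p = 0 ∧ q = 0 ∧ r = 2 * n + 1) ∨
         (e = 3 * n ∧ p ≤ 1 ∧ q = 1 ∧ r = 2 * n) ∨
         (e = 3 * n + 1 ∧ p ≤ 2 ∧ q = 0 ∧ r = 2 * n + 1) ∨
         (e = 3 * n + 2 ∧ p = 0 ∧ q = 2 ∧ r = 2 * n + 1))))
    (h5 : ¬ (d = 4 ∧ e = 5 ∧ p = 0 ∧ q = 0 ∧ r = 5))
    (hp : p ≤ p') (h : (d + 1) * (e + 1) ≤ p' + 3 * q + 6 * r) :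
    RectInjective F (d + 1) (e + 1) p' q r := by
  obtain rfl | rfl | rfl | rfl | rfl | hd :
    d = 0 ∨ d = 1 ∨ d = 2 ∨ d = 3 ∨ d = 4 ∨ 5 ≤ d := by omega
  · exact rectInjective_one h2 (by omega)
  · exact rectInjective_two h2 (by omega)
  · exact rectInjective_three h2 h (by omega)
  · refine rectInjective_four h2 (by omega) h fun hex => h4 ⟨rfl, e / 3, by omega, ?_⟩
    rcases hex with ⟨hr, h | h | h | h⟩
    · exact .inl (by omega)
    · exact .inr (.inl (by omega))
    · exact .inr (.inr (.inl (by omega)))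
    · exact .inr (.inr (.inr (by omega)))
  · exact rectInjective_five h2 (by omega) h (by omega)
  · exact rectInjective_ge_six h2 (by omega) (by omega) h

end LinSys

theorem theorem1 {K : Type*} [Field K] (hK : (2 : K) ≠ 0) (d e p q r : ℕ) (hde : d ≤ e) :
    LinSys.IsSpecial K (LinSys.rectangle d e) (LinSys.mults p q r) ↔
      (d = 0 ∧ p + 2 * q + 3 * r ≤ e ∧ (1 ≤ q ∨ 1 ≤ r)) ∨
      (d = 1 ∧ p + 3 * q + 5 * r ≤ 2 * e + 1 ∧ 1 ≤ r) ∨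
      (d = 2 ∧ p = 0 ∧ (e : ℤ) = q + 2 * r - 1 ∧ ¬ 2 ∣ q + r) ∨
      (d = 3 ∧ ∃ n : ℕ, 1 ≤ n ∧
        ((e = 3 * n ∧ p = 0 ∧ q = 0 ∧ r = 2 * n + 1) ∨
         (e = 3 * n ∧ p ≤ 1 ∧ q = 1 ∧ r = 2 * n) ∨
         (e = 3 * n + 1 ∧ p ≤ 2 ∧ q = 0 ∧ r = 2 * n + 1) ∨
         (e = 3 * n + 2 ∧ p = 0 ∧ q = 2 ∧ r = 2 * n + 1))) ∨
      (d = 4 ∧ e = 5 ∧ p = 0 ∧ q = 0 ∧ r = 5) := by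
  constructor
  · intro hs
    by_contra hex
    simp only [not_or] at hex
    obtain ⟨h0, h1, h3, h4, h5⟩ := hex
    have h2 : (2 : LinSys.InfiniteExt K) ≠ 0 := by
      rw [← map_ofNat (algebraMap K (LinSys.InfiniteExt K)) 2]
      exact (map_ne_zero _).mpr hK
    have hinj {p' : ℕ} (hp : p ≤ p') (h : (d + 1) * (e + 1) ≤ p' + 3 * q + 6 * r) :=
      LinSys.rectInjective_of_not_exceptional h2 hde h0 h1
        (fun ⟨hd, hp, he, hqr⟩ => h3 ⟨hd, hp, by omega, hqr⟩) h4 h5 hp h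
    rcases Nat.le_total ((d + 1) * (e + 1)) (p + 3 * q + 6 * r) with h | h
    · exact LinSys.not_isSpecial_of_le (hinj le_rfl h) h hs
    · obtain ⟨k, hk⟩ := Nat.exists_eq_add_of_le h
      have hsq : (d + 1) * (e + 1) = p + k + 3 * q + 6 * r := by omega
      exact LinSys.not_isSpecial_of_square (Nat.le_add_right p k)
        (hinj (Nat.le_add_right p k) hsq.le) hsq hs
  · rintro (⟨rfl, h, hqr⟩ | ⟨rfl, h, hr⟩ | ⟨rfl, rfl, he, hqr⟩ | ⟨rfl, n, -, h⟩ |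
      ⟨rfl, rfl, rfl, rfl, rfl⟩)
    · exact LinSys.isSpecial_zero h hqr
    · exact LinSys.isSpecial_one h hr
    · exact LinSys.isSpecial_two (by omega) hqr
    · exact LinSys.isSpecial_three h
    · exact LinSys.isSpecial_four
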